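/- **The game.** Fix integers $p\ge 1$, $n\ge 0$ and reals $\varepsilon,\delta$ with $1/\delta\in\mathbb N$ and $\delta<1$. Initially cup $j\in\{1,\dots,n\}$ contains $x_j\ge 0$ units of water, $\sum_j x_j=b$. In each step $i=1,2,\dots$ of the renormalized multi-processor cup game an oblivious filler (all of its moves are fixed in advance) pours $c_j(i)\in[0,1]$ units into each cup $j$, with $\sum_j c_j(i)\le(1-\varepsilon)p$; then the emptier removes up to $1+2\delta$ units from each of up to $p+1$ cups. The backlog after step $i$ is the amount of water in the fullest cup. **The algorithm.** For every cup $j$ and every positive integer $k\equiv 1 \pmod{1/\delta+1}$ draw $s_j(k)$ uniformly from $(0,1]$, all independent, and put thresholds $r_j(k+m)=k+m+s_j(k)$, $m=1,\dots,1/\delta$, in cup $j$. Let $a_j(i)=x_j+\sum_{m\le i}c_j(m)$. The counter $w_j$ of cup $j$ starts at $(1+\delta)$ times the number of thresholds in $(0,x_j]$, and in step $i$ the pouring increases it by $(1+\delta)$ times the number of thresholds in $(a_j(i-1),a_j(i)]$. Then the multi-processor smoothed greedy algorithm selects $p+1$ cups (all cups if $n\le p$), giving priority to cups with $w_j\ge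 1+\delta$, then to cups with $w_j\ne 0$, then to cups with $w_j=0$, and choosing fullest cups within each priority level (ties broken arbitrarily); it removes $\min(1+2\delta,w_j)$ units of water from each selected cup $j$ and decreases $w_j$ by the same amount. **Theorem.** There are absolute constants $A,a,C,c>0$ and, for each $d\in\mathbb N$, constants $B_d,C_d,c_d>0$ depending only on $d$, such that the following holds whenever $p^{-1/3}\le\varepsilon\le 1/2$ and $A e^{-a\varepsilon^2p}\le\delta<1$ (with $1/\delta\in\mathbb N$), for all $n$, all starting states, all filler strategies as above, and every step $i$ with $i\ge\delta^{-8}p^2$ and $i\ge 2b/\delta$. 1. After step $i$ the backlog is at most $3$ with probability at least $1-Ce^{-c\varepsilon^2p}-Ce^{-c\,i^{1/6}}$. 2. For every $d\in\mathbb N$ with $\delta\ge p^{-d}$ and every real $k\ge\ln p$, the backlog after step $i$ is at most $B_d\,k/\varepsilon$ with probability at least $1-C_de^{-e^k}-C_de^{-c_d\,i^{1/6}}$. -/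

import Mathlib

namespace CupGame

/-- A configuration of the `n` cups: the amount of water in each cup, and the value of the
emptier's threshold counter of each cup. -/
structure State (n : ℕ) where
  fill : Fin n → ℝ
  counter : Fin n → ℝ

/-- The backlog is the amount of water in the fullest cup. -/
noncomputable def backlog {n : ℕ} (f : Fin n → ℝ) : ℝ := ⨆ j, f j

/-- The filler's moves in the renormalized `p`-processor game: `c i j` is the amount poured into
cup `j` in step `i` (`i = 1, 2, …`); at most one unit goes to any cup, and at most `(1 - ε) p`
units are poured per step. The function `c` is fixed in advance (the filler is oblivious). -/
structure IsFiller {n : ℕ} (p : ℕ) (ε : ℝ) (c : ℕ → Fin n → ℝ) : Prop where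
  nonneg : ∀ i j, 0 ≤ c i j
  le_one : ∀ i j, c i j ≤ 1
  sum_le : ∀ i, ∑ j, c i j ≤ (1 - ε) * p

/-- The emptier's random values `s j q`, for each cup `j` and each threshold collection
`q = 0, 1, 2, …` of that cup, are independent and uniformly distributed on `(0, 1]`. -/
structure IsUniformOffsets {Ω : Type*} [MeasurableSpace Ω] (μ : MeasureTheory.Measure Ω) {n : ℕ}
    (s : Fin n → ℕ → Ω → ℝ) : Prop where
  measurable : ∀ j q, Measurable (s j q)
  law : ∀ j q, μ.map (s j q) = MeasureTheory.volume.restrict (Set.Ioc (0 : ℝ) 1)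
  indep : ProbabilityTheory.iIndepFun (fun a : Fin n × ℕ => s a.1 a.2) μ

/-- With `D = 1/δ`, the index `t` carries a threshold unless `t = 0` or `t ≡ 1 (mod D + 1)`. -/
def HasThreshold (D t : ℕ) : Prop := t ≠ 0 ∧ t % (D + 1) ≠ 1

/-- The threshold with index `t` in a cup whose collections have random values `s 0, s 1, …`.
The collection `q` consists of the thresholds with the `D` indices
`k + 1, …, k + D`, where `k = q (D + 1) + 1`. -/
noncomputable def threshold (D : ℕ) (s : ℕ → ℝ) (t : ℕ) : ℝ := t + s ((t - 1) / (D + 1))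

/-- The number of thresholds crossed when the total amount of water ever placed in a cup grows
from `x` to `y`. -/
noncomputable def crossings (D : ℕ) (s : ℕ → ℝ) (x y : ℝ) : ℕ :=
  {t : ℕ | HasThreshold D t ∧ x < threshold D s t ∧ threshold D s t ≤ y}.ncard

/-- The total amount of water ever placed in cup `j` by the end of step `i`: the `x j` units
present at the start of the game, and what was poured during the steps `1, …, i`. -/
noncomputable def total {n : ℕ} (x : Fin n → ℝ) (c : ℕ → Fin n → ℝ) (i : ℕ) (j : Fin n) : ℝ :=
  x j + ∑ m ∈ Finset.Icc 1 i, c m j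

/-- The start of the game: cup `j` holds `x j` units, and its counter has received `1 + δ` for
each threshold crossed by these `x j` units. -/
noncomputable def initState {n : ℕ} (D : ℕ) (s : Fin n → ℕ → ℝ) (x : Fin n → ℝ) : State n where
  fill := x
  counter := fun j => (1 + 1 / (D : ℝ)) * crossings D (s j) 0 (x j)

/-- The configuration in the middle of step `i + 1`, after the filler's move; `σ` is the
configuration after step `i`. A counter grows by `1 + δ` for each threshold crossed. -/
noncomputable def afterFill {n : ℕ} (D : ℕ) (s : Fin n → ℕ → ℝ) (x : Fin n → ℝ)
    (c : ℕ → Fin n → ℝ) (i : ℕ) (σ : State n) : State n where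
  fill := fun j => σ.fill j + c (i + 1) j
  counter := fun j => σ.counter j +
    (1 + 1 / (D : ℝ)) * crossings D (s j) (total x c i j) (total x c (i + 1) j)

/-- The emptier empties from the cups in `S`: `min (1 + 2δ) w_j` is removed from the water and
from the counter of each cup `j` in `S`. -/
noncomputable def afterEmpty {n : ℕ} (D : ℕ) (S : Finset (Fin n)) (σ : State n) : State n where
  fill := fun j => if j ∈ S then σ.fill j - min (1 + 2 / (D : ℝ)) (σ.counter j) else σ.fill j
  counter := fun j =>
    if j ∈ S then σ.counter j - min (1 + 2 / (D : ℝ)) (σ.counter j) else σ.counter j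

/-- The configuration after step `i`, if the emptier empties from the cups in `S m` in step `m`. -/
noncomputable def stateAfter {n : ℕ} (D : ℕ) (s : Fin n → ℕ → ℝ) (x : Fin n → ℝ)
    (c : ℕ → Fin n → ℝ) (S : ℕ → Finset (Fin n)) : ℕ → State n
  | 0 => initState D s x
  | i + 1 => afterEmpty D (S (i + 1)) (afterFill D s x c i (stateAfter D s x c S i))

/-- The priority level of a cup with counter `w`: first the cups with `w ≥ 1 + δ`, then the other
cups with `w ≠ 0`, then the cups with `w = 0`. -/
noncomputable def priority (D : ℕ) (w : ℝ) : ℕ :=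
  if 1 + 1 / (D : ℝ) ≤ w then 2 else if w ≠ 0 then 1 else 0

/-- The emptier's choice in the multi-processor smoothed greedy algorithm: `p + 1` cups (all the
cups, if there are fewer) are taken in the order of their priority, and within a priority level
the fullest cups are taken. Ties may be broken in any way. -/
structure IsGreedyChoice {n : ℕ} (D p : ℕ) (σ : State n) (S : Finset (Fin n)) : Prop where
  card_eq : S.card = min (p + 1) n
  greedy : ∀ j ∈ S, ∀ j' ∉ S,
    priority D (σ.counter j') < priority D (σ.counter j) ∨
      (priority D (σ.counter j') = priority D (σ.counter j) ∧ σ.fill j' ≤ σ.fill j)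

/-- The choices `S 1, S 2, …` are those of the multi-processor smoothed greedy algorithm with
random values `s`, in the game that starts with `x j` units in cup `j` and in which the filler
pours `c`. -/
def FollowsSmoothedGreedy {n : ℕ} (D p : ℕ) (s : Fin n → ℕ → ℝ) (x : Fin n → ℝ)
    (c : ℕ → Fin n → ℝ) (S : ℕ → Finset (Fin n)) : Prop :=
  ∀ i, IsGreedyChoice D p (afterFill D s x c i (stateAfter D s x c S i)) (S (i + 1))

end CupGame

/-! Emptying changes the fill and the counter of a cup by the same amount, so their difference
depends only on the water ever placed in the cup. Of every `D + 1` indices, `D` carry a threshold,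
each worth `1 + 1/D`; hence the difference lies between 0 and 3 (`counter_le_total`,
`total_le_counter`). In a clear state, where all counters vanish, the backlog is therefore at most
3. It remains to show that clear states recur quickly.

The thresholds of a cup are at least 1 apart, so a step crosses at most one per cup. A single
threshold `t` is uniform on `(t, t + 1]`. The number `N` of crossings (arrivals) in a step is thus a
sum of independent indicators, one per collection, with mean at most `(1 - ε) p`. A step that does
not end clear lowers the sum of all counters by at least `1/D - 2 (N - p)⁺` (`sum_counter_succ_le`).
If the last clear time before `i` is `u`, the excesses `(N - p)⁺` since `u` add up to at least `(i -
u)/(4D)`, while a Chernoff bound makes their expectation at most half of that (`integral_excess_le`,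
`expected_excess_small`).

Different steps are dependent, because one collection serves up to `D` steps. Resetting one offset
raises the sum of the excesses by at most the number of crossings that the new value causes. This
number is at most `D`, and its expectations over all collections add up to at most `p` per step. An
exponential moment bound for such functions (`integral_exp_pi_le_of_osc`) shows that large excess
over `m` steps has probability at most `exp(-m/(512 p D³))`, however many cups and collections there
are. A union bound over `u` yields `measure_not_recently_clear_le`.

For the first claim the window is polynomial in `p` and `D`. A clear state stays clear while at most
`p` thresholds are crossed per step (`isClear_succ`), and more than `p` is rare enough for a union
bound over the window. For the second claim the window has length of order `exp k`, and within it a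
deterministic potential suffices: the sum of `max (exp(ε(h - 8))) 1` over the fills `h` grows by at
most `2p` per step (`IsGreedyChoice.excessWeight_le`), so the backlog is logarithmic in the window,
divided by `ε`. -/

namespace CupGame

/-! ### Counting the thresholds crossed in one cup -/

/-- The contribution of the threshold with index `t`, if it has offset `u`, to the number of
crossings between `x` and `y`. -/
noncomputable def hit (D t : ℕ) (u x y : ℝ) : ℕ :=
  open Classical in if HasThreshold D t ∧ x < t + u ∧ t + u ≤ y then 1 else 0

theorem crossings_eq_sum {D T : ℕ} {s : ℕ → ℝ} (hs : ∀ q, s q ∈ Set.Ioc (0 : ℝ) 1) {x y : ℝ}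
    (hT : y ≤ T) :
    crossings D s x y = ∑ t ∈ Finset.range T, hit D t (s ((t - 1) / (D + 1))) x y := by
  classical
  have h : {t : ℕ | HasThreshold D t ∧ x < threshold D s t ∧ threshold D s t ≤ y} =
      ((Finset.range T).filter fun t : ℕ =>
        HasThreshold D t ∧ x < threshold D s t ∧ threshold D s t ≤ y : Finset ℕ) := by
    ext t
    simp only [Set.mem_ofPred_eq, Finset.coe_filter, Finset.mem_range]
    refine ⟨fun h => ⟨?_, h⟩, fun h => h.2⟩
    have h1 := h.2.2
    have h2 := (hs ((t - 1) / (D + 1))).1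
    unfold threshold at h1
    have : (t : ℝ) < T := by linarith
    exact_mod_cast this
  unfold crossings
  rw [h, Set.ncard_coe_finset, Finset.card_filter]
  refine Finset.sum_congr rfl fun t _ => ?_
  unfold hit threshold
  congr

theorem hit_add {D t : ℕ} {u x y z : ℝ} (hxy : x ≤ y) (hyz : y ≤ z) :
    hit D t u x y + hit D t u y z = hit D t u x z := by
  unfold hit
  by_cases h : HasThreshold D t <;> simp only [h, true_and, false_and, if_false, add_zero]
  rcases le_or_gt ((t : ℝ) + u) x with h1 | h1
  · rw [if_neg (by rintro ⟨_, _⟩; linarith), if_neg (by rintro ⟨_, _⟩; linarith),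
      if_neg (by rintro ⟨_, _⟩; linarith)]
  rcases le_or_gt ((t : ℝ) + u) y with h2 | h2
  · rw [if_pos ⟨h1, h2⟩, if_neg (by rintro ⟨_, _⟩; linarith), if_pos ⟨h1, h2.trans hyz⟩]
  rcases le_or_gt ((t : ℝ) + u) z with h3 | h3
  · rw [if_neg (by rintro ⟨_, _⟩; linarith), if_pos ⟨h2, h3⟩, if_pos ⟨h1, h3⟩]
  · rw [if_neg (by rintro ⟨_, _⟩; linarith), if_neg (by rintro ⟨_, _⟩; linarith),
      if_neg (by rintro ⟨_, _⟩; linarith)]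

theorem crossings_add {D : ℕ} {s : ℕ → ℝ} (hs : ∀ q, s q ∈ Set.Ioc (0 : ℝ) 1) {x y z : ℝ}
    (hxy : x ≤ y) (hyz : y ≤ z) :
    crossings D s x y + crossings D s y z = crossings D s x z := by
  obtain ⟨T, hT⟩ := exists_nat_ge z
  rw [crossings_eq_sum hs (hyz.trans hT), crossings_eq_sum hs hT, crossings_eq_sum hs hT,
    ← Finset.sum_add_distrib]
  exact Finset.sum_congr rfl fun t _ => hit_add hxy hyz

theorem HasThreshold.block_succ {D t : ℕ} (hD : 1 ≤ D) (h : HasThreshold D t)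
    (h' : HasThreshold D (t + 1)) : t / (D + 1) = (t - 1) / (D + 1) := by
  obtain ⟨k, rfl⟩ : ∃ k, t = k + 1 := ⟨t - 1, by have := h.1; omega⟩
  have h2 := h'.2
  rw [Nat.add_sub_cancel, Nat.succ_div, if_neg, add_zero]
  rintro ⟨m, hm⟩
  apply h2
  rw [hm, Nat.mul_add_mod]
  exact Nat.mod_eq_of_lt (by omega)

/-- Within a collection the offsets agree, so consecutive thresholds differ by exactly 1. Between
collections an index is skipped, and a gap of 2 outweighs the difference of two offsets in `(0, 1]`.
-/
theorem threshold_add_one_le {D : ℕ} (hD : 1 ≤ D) {s : ℕ → ℝ}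
    (hs : ∀ q, s q ∈ Set.Ioc (0 : ℝ) 1) {t t' : ℕ} (h : HasThreshold D t) (h' : HasThreshold D t')
    (htt : t < t') : threshold D s t + 1 ≤ threshold D s t' := by
  unfold threshold
  rcases Nat.lt_or_ge (t + 1) t' with hlt | hge
  · have h1 := (hs ((t - 1) / (D + 1))).2
    have h2 := (hs ((t' - 1) / (D + 1))).1
    have : (t : ℝ) + 2 ≤ t' := by exact_mod_cast hlt
    linarith
  · obtain rfl : t' = t + 1 := by omega
    rw [Nat.add_sub_cancel, h.block_succ hD h']
    push_cast
    linarith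

theorem crossings_le_one {D : ℕ} (hD : 1 ≤ D) {s : ℕ → ℝ}
    (hs : ∀ q, s q ∈ Set.Ioc (0 : ℝ) 1) {x y : ℝ} (hxy : y ≤ x + 1) : crossings D s x y ≤ 1 := by
  unfold crossings
  rw [Set.ncard_le_one ?_]
  · rintro t ⟨h, h1, h2⟩ t' ⟨h', h1', h2'⟩
    rcases lt_trichotomy t t' with hlt | heq | hgt
    · have := threshold_add_one_le hD hs h h' hlt
      linarith
    · exact heq
    · have := threshold_add_one_le hD hs h' h hgt
      linarith
  · obtain ⟨T, hT⟩ := exists_nat_ge y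
    refine (Set.finite_lt_nat T).subset ?_
    rintro t ⟨_, _, h2⟩
    have h3 := (hs ((t - 1) / (D + 1))).1
    unfold threshold at h2
    have : (t : ℝ) < T := by linarith
    exact_mod_cast this

-- The quotient is `⌈T / (D + 1)⌉`, the number of skipped indices among `1, …, T`.
open Classical in
theorem sum_hasThreshold (D T : ℕ) (hD : 1 ≤ D) :
    (∑ t ∈ Finset.range (T + 1), if HasThreshold D t then 1 else 0) + (T + D) / (D + 1) = T := by
  induction T with
  | zero => simp [HasThreshold, Nat.div_eq_of_lt]
  | succ T ih =>
    rw [Finset.sum_range_succ]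
    have e : (T + 1 + D) / (D + 1) = (T + D) / (D + 1) + if D + 1 ∣ T then 1 else 0 := by
      rw [show T + 1 + D = T + D + 1 by ring, Nat.succ_div]
      have : D + 1 ∣ T + D + 1 ↔ D + 1 ∣ T := by
        rw [show T + D + 1 = T + (D + 1) by ring, Nat.dvd_add_left (dvd_refl _)]
      simp only [this]
    have hiff : HasThreshold D (T + 1) ↔ ¬ (D + 1 ∣ T) := by
      unfold HasThreshold
      rw [Nat.dvd_iff_mod_eq_zero]
      have hlt : T % (D + 1) < D + 1 := Nat.mod_lt _ (by omega)
      have := Nat.add_mod T 1 (D + 1)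
      rw [Nat.mod_eq_of_lt (show 1 < D + 1 by omega)] at this
      rw [this]
      constructor
      · rintro ⟨_, h⟩ h0
        rw [h0] at h
        exact h (Nat.mod_eq_of_lt (by omega))
      · refine fun h => ⟨by omega, fun h1 => ?_⟩
        rcases Nat.lt_or_ge (T % (D + 1) + 1) (D + 1) with h2 | h2
        · rw [Nat.mod_eq_of_lt h2] at h1
          omega
        · rw [show T % (D + 1) + 1 = D + 1 by omega, Nat.mod_self] at h1
          omega
    rw [e]
    by_cases hd : D + 1 ∣ T <;> simp only [hiff, hd, not_true, not_false_iff, if_true, if_false] <;>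
      omega

/-- Only indices up to `⌊y⌋` can be crossed. Each block of `D + 1` indices begins with the skipped
one, so at most the fraction `D / (D + 1)` of them carries a threshold. -/
theorem counter_le_total {D : ℕ} (hD : 1 ≤ D) {s : ℕ → ℝ} (hs : ∀ q, s q ∈ Set.Ioc (0 : ℝ) 1)
    {y : ℝ} (hy : 0 ≤ y) : (1 + 1 / (D : ℝ)) * crossings D s 0 y ≤ y := by
  classical
  have hT : y ≤ (⌊y⌋₊ + 1 : ℕ) := by push_cast; exact (Nat.lt_floor_add_one y).le
  rw [crossings_eq_sum hs hT]
  have h1 : ∑ t ∈ Finset.range (⌊y⌋₊ + 1), hit D t (s ((t - 1) / (D + 1))) 0 y ≤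
      ∑ t ∈ Finset.range (⌊y⌋₊ + 1), if HasThreshold D t then 1 else 0 := by
    refine Finset.sum_le_sum fun t _ => ?_
    unfold hit
    split_ifs with ha hb <;> simp_all
  have h2 := sum_hasThreshold D ⌊y⌋₊ hD
  set A := ∑ t ∈ Finset.range (⌊y⌋₊ + 1), hit D t (s ((t - 1) / (D + 1))) 0 y
  set B := ∑ t ∈ Finset.range (⌊y⌋₊ + 1), if HasThreshold D t then 1 else 0
  set q := (⌊y⌋₊ + D) / (D + 1)
  have h3 : ⌊y⌋₊ ≤ q * (D + 1) := by
    have := Nat.div_add_mod (⌊y⌋₊ + D) (D + 1)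
    have hlt : (⌊y⌋₊ + D) % (D + 1) < D + 1 := Nat.mod_lt _ (by omega)
    rw [mul_comm] at this
    change q * (D + 1) + _ = _ at this
    omega
  have h4 : A * (D + 1) ≤ ⌊y⌋₊ * D := by nlinarith
  have h5 : (A : ℝ) * (D + 1) ≤ ⌊y⌋₊ * D := by exact_mod_cast h4
  have hDpos : (0 : ℝ) < D := by exact_mod_cast hD
  have h6 := Nat.floor_le hy
  have e : (1 + 1 / (D : ℝ)) * A = A * (D + 1) / D := by field_simp
  rw [e, div_le_iff₀ hDpos]
  nlinarith

/-- Every threshold of index at most `T = ⌊y⌋ - 1` has been crossed, whatever the offsets. Rounding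
loses less than 2 in `y < T + 2`, and a partial block loses at most 1 more. -/
theorem total_le_counter {D : ℕ} (hD : 1 ≤ D) {s : ℕ → ℝ} (hs : ∀ q, s q ∈ Set.Ioc (0 : ℝ) 1)
    (y : ℝ) : y ≤ (1 + 1 / (D : ℝ)) * crossings D s 0 y + 3 := by
  classical
  have hDpos : (0 : ℝ) < D := by exact_mod_cast hD
  rcases lt_or_ge y 1 with hy | hy
  · have : 0 ≤ (1 + 1 / (D : ℝ)) * crossings D s 0 y := by positivity
    linarith
  have hT : y ≤ (⌊y⌋₊ + 1 : ℕ) := by push_cast; exact (Nat.lt_floor_add_one y).le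
  obtain ⟨T, hTT⟩ : ∃ T, ⌊y⌋₊ = T + 1 :=
    ⟨⌊y⌋₊ - 1, by have := (Nat.one_le_floor_iff y).2 hy; omega⟩
  have hfl := Nat.floor_le (zero_le_one.trans hy)
  have hfl' := Nat.lt_floor_add_one y
  rw [crossings_eq_sum hs hT, hTT]
  rw [hTT] at hfl hfl'
  have h1 : (∑ t ∈ Finset.range (T + 1), if HasThreshold D t then 1 else 0) ≤
      ∑ t ∈ Finset.range (T + 1 + 1), hit D t (s ((t - 1) / (D + 1))) 0 y := by
    rw [Finset.sum_range_succ _ (T + 1)]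
    refine le_trans (Finset.sum_le_sum fun t ht => ?_) (Nat.le_add_right _ _)
    unfold hit
    by_cases ha : HasThreshold D t
    · have ht' : (t : ℝ) ≤ T := by
        have := Finset.mem_range.1 ht
        exact_mod_cast (by omega : t ≤ T)
      have h2 := hs ((t - 1) / (D + 1))
      rw [if_pos ha, if_pos]
      refine ⟨ha, add_pos_of_nonneg_of_pos (Nat.cast_nonneg t) h2.1, ?_⟩
      push_cast at hfl
      linarith [h2.2]
    · simp [ha]
  have h2 := sum_hasThreshold D T hD
  set A := ∑ t ∈ Finset.range (T + 1 + 1), hit D t (s ((t - 1) / (D + 1))) 0 y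
  set B := ∑ t ∈ Finset.range (T + 1), if HasThreshold D t then 1 else 0
  have h3 : (T + D) / (D + 1) * (D + 1) ≤ T + D := Nat.div_mul_le_self _ _
  set q := (T + D) / (D + 1)
  have h4 : T * D ≤ A * (D + 1) + D := by nlinarith
  have h5 : (T : ℝ) * D ≤ A * (D + 1) + D := by exact_mod_cast h4
  have e : (1 + 1 / (D : ℝ)) * A = A * (D + 1) / D := by field_simp
  have h6 : (T : ℝ) - 1 ≤ A * (D + 1) / D := by
    rw [le_div_iff₀ hDpos]
    nlinarith
  rw [e]
  push_cast at hfl'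
  linarith

/-! ### The greedy choice and the sum of the counters -/

/-- The number of thresholds crossed, in all cups together, in step `i + 1`. -/
noncomputable def arrivals {n : ℕ} (D : ℕ) (s : Fin n → ℕ → ℝ) (x : Fin n → ℝ)
    (c : ℕ → Fin n → ℝ) (i : ℕ) : ℕ :=
  ∑ j, crossings D (s j) (total x c i j) (total x c (i + 1) j)

/-- All counters vanish. -/
def State.IsClear {n : ℕ} (σ : State n) : Prop := ∀ j, σ.counter j = 0

open Classical in
/-- The cups of the highest priority level. -/
noncomputable def State.urgent {n : ℕ} (D : ℕ) (σ : State n) : Finset (Fin n) :=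
  Finset.univ.filter fun j => 1 + 1 / (D : ℝ) ≤ σ.counter j

theorem State.mem_urgent {n D : ℕ} {σ : State n} {j : Fin n} :
    j ∈ σ.urgent D ↔ 1 + 1 / (D : ℝ) ≤ σ.counter j := by
  simp [State.urgent]

theorem priority_eq_two {D : ℕ} {w : ℝ} : priority D w = 2 ↔ 1 + 1 / (D : ℝ) ≤ w := by
  unfold priority
  split_ifs <;> simp_all

theorem priority_le_two (D : ℕ) (w : ℝ) : priority D w ≤ 2 := by
  unfold priority
  split_ifs <;> simp

theorem ne_zero_of_priority_pos {D : ℕ} {w : ℝ} (h : 1 ≤ priority D w) : w ≠ 0 := by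
  rintro rfl
  have : ¬ (1 + 1 / (D : ℝ) ≤ 0) := by
    have : (0 : ℝ) ≤ 1 / D := by positivity
    linarith
  rw [priority, if_neg this, if_neg (not_not.2 rfl)] at h
  omega

theorem priority_pos_of_ne_zero {D : ℕ} {w : ℝ} (h : w ≠ 0) : 1 ≤ priority D w := by
  unfold priority
  split_ifs <;> simp_all

theorem IsGreedyChoice.priority_le {n D p : ℕ} {σ : State n} {S : Finset (Fin n)}
    (hS : IsGreedyChoice D p σ S) {j j' : Fin n} (hj : j ∈ S) (hj' : j' ∉ S) :
    priority D (σ.counter j') ≤ priority D (σ.counter j) := by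
  rcases hS.greedy j hj j' hj' with h | h
  · exact h.le
  · exact h.1.le

theorem IsGreedyChoice.subset_urgent_of_mem {n D p : ℕ} {σ : State n} {S : Finset (Fin n)}
    (hS : IsGreedyChoice D p σ S) {j' : Fin n} (h' : j' ∈ σ.urgent D) (hj' : j' ∉ S) :
    S ⊆ σ.urgent D := by
  intro j hj
  have h := hS.priority_le hj hj'
  rw [priority_eq_two.2 (State.mem_urgent.1 h')] at h
  exact State.mem_urgent.2 (priority_eq_two.1 ((priority_le_two D _).antisymm h))

theorem IsGreedyChoice.urgent_subset {n D p : ℕ} {σ : State n} {S : Finset (Fin n)}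
    (hS : IsGreedyChoice D p σ S) (h : (σ.urgent D).card ≤ p + 1) : σ.urgent D ⊆ S := by
  intro j' h'
  by_contra hj'
  have h1 := hS.subset_urgent_of_mem h' hj'
  have h2 : S.card < (σ.urgent D).card :=
    Finset.card_lt_card ⟨h1, fun hss => hj' (hss h')⟩
  have h3 := hS.card_eq
  have h4 : (σ.urgent D).card ≤ n := by simpa using Finset.card_le_univ (σ.urgent D)
  omega

theorem IsGreedyChoice.subset_urgent {n D p : ℕ} {σ : State n} {S : Finset (Fin n)}
    (hS : IsGreedyChoice D p σ S) (h : p + 1 ≤ (σ.urgent D).card) : S ⊆ σ.urgent D := by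
  intro j hj
  by_contra hju
  have h3 := hS.card_eq
  by_cases hss : σ.urgent D ⊆ S
  · have h2 : (σ.urgent D).card < S.card := Finset.card_lt_card ⟨hss, fun hs => hju (hs hj)⟩
    omega
  · obtain ⟨j', h', hj'⟩ := Finset.not_subset.1 hss
    exact hju (hS.subset_urgent_of_mem h' hj' hj)

/-- Unless a step ends with all counters zero, it removes, up to the excess of the number `N` of
arrivals over `p`, more from the counters than the `N` arrivals have added. -/
theorem IsGreedyChoice.le_sum_removed {n D p N : ℕ} (hD : 1 ≤ D) {σ : State n}
    (hnat : ∀ j, ∃ k : ℕ, σ.counter j = k / D) {S : Finset (Fin n)}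
    (hS : IsGreedyChoice D p σ S) (hN : N ≤ (σ.urgent D).card)
    (hclear : ¬ (afterEmpty D S σ).IsClear) :
    (1 + 1 / (D : ℝ)) * N + 1 / D - 2 * (N - p : ℕ) ≤
      ∑ j ∈ S, min (1 + 2 / (D : ℝ)) (σ.counter j) := by
  classical
  have hD1 : (1 : ℝ) ≤ D := by exact_mod_cast hD
  have hδ0 : 0 < 1 / (D : ℝ) := by positivity
  have hδ1 : 1 / (D : ℝ) ≤ 1 := by rw [div_le_one (by linarith)]; exact hD1
  have h2δ : 2 / (D : ℝ) = 2 * (1 / D) := by ring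
  set δ := 1 / (D : ℝ) with hδ
  rw [h2δ]
  have hw0 : ∀ j, 0 ≤ min (1 + 2 * δ) (σ.counter j) := fun j => by
    obtain ⟨k, hk⟩ := hnat j
    rw [hk]
    exact le_min (by linarith) (by positivity)
  have hwδ : ∀ j, σ.counter j ≠ 0 → δ ≤ min (1 + 2 * δ) (σ.counter j) := fun j hj => by
    obtain ⟨k, hk⟩ := hnat j
    refine le_min (by linarith) ?_
    rw [hk] at hj ⊢
    have : k ≠ 0 := by rintro rfl; simp at hj
    have : (1 : ℝ) ≤ k := by exact_mod_cast Nat.one_le_iff_ne_zero.2 this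
    rw [hδ]
    gcongr
  have hwu : ∀ j ∈ σ.urgent D, 1 + δ ≤ min (1 + 2 * δ) (σ.counter j) := fun j hj =>
    le_min (by linarith) (State.mem_urgent.1 hj)
  have hNp : (N : ℝ) - p ≤ (N - p : ℕ) := by
    have : N ≤ p + (N - p) := by omega
    have : (N : ℝ) ≤ p + (N - p : ℕ) := by exact_mod_cast this
    linarith
  have hNp0 : (0 : ℝ) ≤ (N - p : ℕ) := Nat.cast_nonneg _
  rcases Nat.lt_or_ge p (σ.urgent D).card with hlt | hge
  -- All `p + 1` selected cups lose at least `1 + δ`. Each arrival beyond `p` costs `1 + δ ≤ 2`,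
  -- which is the origin of the factor 2.
  · have hsub := hS.subset_urgent hlt
    have h4 : (σ.urgent D).card ≤ n := by simpa using Finset.card_le_univ (σ.urgent D)
    have hcard : S.card = p + 1 := by have := hS.card_eq; omega
    have h1 : (S.card : ℝ) * (1 + δ) ≤ ∑ j ∈ S, min (1 + 2 * δ) (σ.counter j) := by
      rw [← nsmul_eq_mul]
      exact Finset.card_nsmul_le_sum _ _ _ fun j hj => hwu j (hsub hj)
    rw [hcard] at h1
    push_cast at h1
    nlinarith
  · have hsub := hS.urgent_subset (hge.trans (Nat.le_succ p))
    have h1 : ((σ.urgent D).card : ℝ) * (1 + δ) + δ ≤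
        ∑ j ∈ S, min (1 + 2 * δ) (σ.counter j) := by
      have hbase : ∀ U : Finset (Fin n), U ⊆ σ.urgent D →
          (U.card : ℝ) * (1 + δ) ≤ ∑ j ∈ U, min (1 + 2 * δ) (σ.counter j) := fun U hU => by
        rw [← nsmul_eq_mul]
        exact Finset.card_nsmul_le_sum _ _ _ fun j hj => hwu j (hU hj)
      -- Source of the additional `δ`: a counter that survives belongs either to a selected cup with
      -- more than `1 + 2δ`, which then loses `1 + 2δ`, or to an unselected cup. In the latter case
      -- one of the `p + 1` selected cups is not urgent, has a nonzero counter by priority, and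
      -- loses at least `δ` because counters are multiples of `δ`.
      have hex : (∃ j ∈ σ.urgent D, 1 + 2 * δ < σ.counter j) ∨
          ∃ j ∈ S, j ∉ σ.urgent D ∧ σ.counter j ≠ 0 := by
        simp only [State.IsClear, not_forall] at hclear
        obtain ⟨j, hj⟩ := hclear
        simp only [afterEmpty] at hj
        rw [h2δ] at hj
        by_cases hjS : j ∈ S
        · rw [if_pos hjS] at hj
          have : 1 + 2 * δ < σ.counter j := by
            by_contra hle
            rw [min_eq_right (not_lt.1 hle), sub_self] at hj
            exact hj rfl
          exact Or.inl ⟨j, State.mem_urgent.2 (by linarith), this⟩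
        · rw [if_neg hjS] at hj
          have hSn : S.card < n := by
            simpa using Finset.card_lt_univ_of_notMem hjS
          have hcard := hS.card_eq
          obtain ⟨j₁, hj₁, hj₁u⟩ : ∃ j₁ ∈ S, j₁ ∉ σ.urgent D := by
            by_contra! hcon
            have := Finset.card_le_card (show S ⊆ σ.urgent D from hcon)
            omega
          exact Or.inr ⟨j₁, hj₁, hj₁u, ne_zero_of_priority_pos
            ((priority_pos_of_ne_zero hj).trans (hS.priority_le hj₁ hjS))⟩
      rcases hex with ⟨j, hju, hj⟩ | ⟨j, hjS, hju, hj⟩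
      · have h2 := hbase ((σ.urgent D).erase j) (Finset.erase_subset _ _)
        have h3 := Finset.add_sum_erase (σ.urgent D)
          (fun j => min (1 + 2 * δ) (σ.counter j)) hju
        have h5 := Finset.card_erase_add_one hju
        have h6 := Finset.sum_le_sum_of_subset_of_nonneg hsub
          (f := fun j => min (1 + 2 * δ) (σ.counter j)) fun j _ _ => hw0 j
        simp only [min_eq_left hj.le] at h3
        rw [← h5]
        push_cast
        linarith
      · have h2 := hbase (σ.urgent D) subset_rfl
        have h6 := Finset.sum_le_sum_of_subset_of_nonneg (Finset.insert_subset hjS hsub)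
          (f := fun j => min (1 + 2 * δ) (σ.counter j)) fun j _ _ => hw0 j
        rw [Finset.sum_insert hju] at h6
        linarith [hwδ j hj]
    have h2 : (N : ℝ) ≤ (σ.urgent D).card := by exact_mod_cast hN
    nlinarith

theorem total_succ {n : ℕ} (x : Fin n → ℝ) (c : ℕ → Fin n → ℝ) (i : ℕ) (j : Fin n) :
    total x c (i + 1) j = total x c i j + c (i + 1) j := by
  unfold total
  rw [Finset.sum_Icc_succ_top (by omega), add_assoc]

theorem total_nonneg {n : ℕ} {x : Fin n → ℝ} {c : ℕ → Fin n → ℝ} (hx : ∀ j, 0 ≤ x j)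
    (hc : ∀ i j, 0 ≤ c i j) (i : ℕ) (j : Fin n) : 0 ≤ total x c i j :=
  add_nonneg (hx j) (Finset.sum_nonneg fun _ _ => hc _ _)

theorem afterEmpty_counter {n D : ℕ} (S : Finset (Fin n)) (σ : State n) (j : Fin n) :
    (afterEmpty D S σ).counter j =
      σ.counter j - if j ∈ S then min (1 + 2 / (D : ℝ)) (σ.counter j) else 0 := by
  unfold afterEmpty
  split_ifs <;> simp_all

theorem afterEmpty_fill {n D : ℕ} (S : Finset (Fin n)) (σ : State n) (j : Fin n) :
    (afterEmpty D S σ).fill j =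
      σ.fill j - if j ∈ S then min (1 + 2 / (D : ℝ)) (σ.counter j) else 0 := by
  unfold afterEmpty
  split_ifs <;> simp_all

theorem afterFill_counter_nat {n D : ℕ} (hD : 1 ≤ D) (s : Fin n → ℕ → ℝ) (x : Fin n → ℝ)
    (c : ℕ → Fin n → ℝ) (i : ℕ) {σ : State n} {j : Fin n} (h : ∃ k : ℕ, σ.counter j = k / D) :
    ∃ k : ℕ, (afterFill D s x c i σ).counter j = k / D := by
  obtain ⟨k, hk⟩ := h
  have hDpos : (0 : ℝ) < D := by exact_mod_cast hD
  refine ⟨k + (D + 1) * crossings D (s j) (total x c i j) (total x c (i + 1) j), ?_⟩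
  simp only [afterFill, hk]
  push_cast
  field_simp

theorem afterEmpty_counter_nat {n D : ℕ} (hD : 1 ≤ D) (S : Finset (Fin n)) {σ : State n}
    {j : Fin n} (h : ∃ k : ℕ, σ.counter j = k / D) :
    ∃ k : ℕ, (afterEmpty D S σ).counter j = k / D := by
  obtain ⟨k, hk⟩ := h
  have hDpos : (0 : ℝ) < D := by exact_mod_cast hD
  rw [afterEmpty_counter]
  split_ifs
  · rcases le_total (1 + 2 / (D : ℝ)) (σ.counter j) with hle | hle
    · rw [min_eq_left hle]
      have e : 1 + 2 / (D : ℝ) = ((D + 2 : ℕ) : ℝ) / D := by push_cast; field_simp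
      rw [hk, e, div_le_div_iff_of_pos_right hDpos] at hle
      have hle' : D + 2 ≤ k := by exact_mod_cast hle
      refine ⟨k - (D + 2), ?_⟩
      rw [hk, e, Nat.cast_sub hle', sub_div]
    · exact ⟨0, by rw [min_eq_right hle]; simp⟩
  · exact ⟨k, by rw [hk, sub_zero]⟩

theorem stateAfter_counter_nat {n D : ℕ} (hD : 1 ≤ D) (s : Fin n → ℕ → ℝ) (x : Fin n → ℝ)
    (c : ℕ → Fin n → ℝ) (S : ℕ → Finset (Fin n)) (i : ℕ) (j : Fin n) :
    ∃ k : ℕ, (stateAfter D s x c S i).counter j = k / D := by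
  induction i with
  | zero =>
    have hDpos : (0 : ℝ) < D := by exact_mod_cast hD
    refine ⟨(D + 1) * crossings D (s j) 0 (x j), ?_⟩
    simp only [stateAfter, initState]
    push_cast
    field_simp
  | succ i ih => exact afterEmpty_counter_nat hD _ (afterFill_counter_nat hD _ _ _ _ ih)

theorem fill_sub_counter {n D : ℕ} {s : Fin n → ℕ → ℝ}
    (hs : ∀ j q, s j q ∈ Set.Ioc (0 : ℝ) 1) {x : Fin n → ℝ} (hx : ∀ j, 0 ≤ x j)
    {c : ℕ → Fin n → ℝ} (hc : ∀ i j, 0 ≤ c i j) (S : ℕ → Finset (Fin n)) (i : ℕ) (j : Fin n) :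
    (stateAfter D s x c S i).fill j - (stateAfter D s x c S i).counter j =
      total x c i j - (1 + 1 / (D : ℝ)) * crossings D (s j) 0 (total x c i j) := by
  induction i with
  | zero => simp [stateAfter, initState, total]
  | succ i ih =>
    have h := crossings_add (D := D) (hs j) (total_nonneg hx hc i j)
      (show total x c i j ≤ total x c (i + 1) j by rw [total_succ]; linarith [hc (i + 1) j])
    simp only [stateAfter, afterEmpty_fill, afterEmpty_counter]
    rw [← h, total_succ]
    simp only [afterFill, ← total_succ]
    push_cast
    linear_combination ih - total_succ x c i j

theorem fill_le_counter_add {n D : ℕ} (hD : 1 ≤ D) {s : Fin n → ℕ → ℝ}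
    (hs : ∀ j q, s j q ∈ Set.Ioc (0 : ℝ) 1) {x : Fin n → ℝ} (hx : ∀ j, 0 ≤ x j)
    {c : ℕ → Fin n → ℝ} (hc : ∀ i j, 0 ≤ c i j) (S : ℕ → Finset (Fin n)) (i : ℕ) (j : Fin n) :
    (stateAfter D s x c S i).fill j ≤ (stateAfter D s x c S i).counter j + 3 := by
  have h := fill_sub_counter (D := D) hs hx hc S i j
  linarith [total_le_counter hD (hs j) (total x c i j)]

theorem crossings_step_le_one {n D : ℕ} (hD : 1 ≤ D) {s : Fin n → ℕ → ℝ}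
    (hs : ∀ j q, s j q ∈ Set.Ioc (0 : ℝ) 1) (x : Fin n → ℝ)
    {c : ℕ → Fin n → ℝ} (hc : ∀ i j, c i j ≤ 1) (i : ℕ) (j : Fin n) :
    crossings D (s j) (total x c i j) (total x c (i + 1) j) ≤ 1 :=
  crossings_le_one hD (hs j) (by rw [total_succ]; linarith [hc (i + 1) j])

/-- A cup with a crossing has just received `1 + δ`, so it is urgent, and it accounts for only one
arrival. -/
theorem arrivals_le_card_urgent {n D : ℕ} (hD : 1 ≤ D) {s : Fin n → ℕ → ℝ}
    (hs : ∀ j q, s j q ∈ Set.Ioc (0 : ℝ) 1) (x : Fin n → ℝ)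
    {c : ℕ → Fin n → ℝ} (hc : ∀ i j, c i j ≤ 1) (i : ℕ) {σ : State n}
    (hσ : ∀ j, 0 ≤ σ.counter j) :
    arrivals D s x c i ≤ ((afterFill D s x c i σ).urgent D).card := by
  unfold arrivals State.urgent
  rw [Finset.card_filter]
  refine Finset.sum_le_sum fun j _ => ?_
  have h1 := crossings_step_le_one hD hs x hc i j
  split_ifs with h
  · exact h1
  · by_contra hcon
    apply h
    have h2 : crossings D (s j) (total x c i j) (total x c (i + 1) j) = 1 := by omega
    simp only [afterFill, h2]
    linarith [hσ j]

/-- After the pouring each counter is 0 or `1 + δ`. The cups of the second kind are urgent and at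
most `p` in number, so all are selected, and `1 + δ` is below the removal limit `1 + 2δ`. -/
theorem isClear_succ {n D p : ℕ} (hD : 1 ≤ D) {s : Fin n → ℕ → ℝ}
    (hs : ∀ j q, s j q ∈ Set.Ioc (0 : ℝ) 1) (x : Fin n → ℝ)
    {c : ℕ → Fin n → ℝ} (hc : ∀ i j, c i j ≤ 1) {S : ℕ → Finset (Fin n)}
    (hS : FollowsSmoothedGreedy D p s x c S) {i : ℕ} (hN : arrivals D s x c i ≤ p)
    (hcl : (stateAfter D s x c S i).IsClear) : (stateAfter D s x c S (i + 1)).IsClear := by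
  classical
  set σ := stateAfter D s x c S i with hσ
  have hδ : 0 < 1 / (D : ℝ) := by
    have : (0 : ℝ) < D := by exact_mod_cast hD
    positivity
  have hw : ∀ j, (afterFill D s x c i σ).counter j =
      (1 + 1 / (D : ℝ)) * crossings D (s j) (total x c i j) (total x c (i + 1) j) := fun j => by
    simp [afterFill, hcl j]
  have hw' : ∀ j, (afterFill D s x c i σ).counter j = 0 ∨
      (afterFill D s x c i σ).counter j = 1 + 1 / (D : ℝ) := fun j => by
    have := crossings_step_le_one hD hs x hc i j
    rw [hw]
    interval_cases crossings D (s j) (total x c i j) (total x c (i + 1) j) <;> simp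
  have hcard : ((afterFill D s x c i σ).urgent D).card ≤ arrivals D s x c i := by
    unfold arrivals State.urgent
    rw [Finset.card_filter]
    refine Finset.sum_le_sum fun j _ => ?_
    split_ifs with h
    · rw [hw] at h
      by_contra hcon
      rw [show crossings D (s j) (total x c i j) (total x c (i + 1) j) = 0 by omega] at h
      norm_num at h
      rw [← one_div] at h
      linarith
    · exact Nat.zero_le _
  have hsub := (hS i).urgent_subset (by rw [← hσ]; omega)
  intro j
  simp only [stateAfter, afterEmpty_counter, ← hσ]
  rcases hw' j with h | h
  · rw [h]
    split_ifs <;> simp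
    positivity
  · rw [if_pos (hsub (State.mem_urgent.2 h.ge)), h, min_eq_right, sub_self]
    have : 2 / (D : ℝ) = 2 * (1 / D) := by ring
    linarith

theorem sum_counter_succ_le {n D p : ℕ} (hD : 1 ≤ D) {s : Fin n → ℕ → ℝ}
    (hs : ∀ j q, s j q ∈ Set.Ioc (0 : ℝ) 1) (x : Fin n → ℝ)
    {c : ℕ → Fin n → ℝ} (hc : ∀ i j, c i j ≤ 1) {S : ℕ → Finset (Fin n)}
    (hS : FollowsSmoothedGreedy D p s x c S) {i : ℕ}
    (hcl : ¬ (stateAfter D s x c S (i + 1)).IsClear) :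
    ∑ j, (stateAfter D s x c S (i + 1)).counter j ≤
      ∑ j, (stateAfter D s x c S i).counter j - 1 / D + 2 * (arrivals D s x c i - p : ℕ) := by
  have hnn : ∀ j, 0 ≤ (stateAfter D s x c S i).counter j := fun j => by
    obtain ⟨k, hk⟩ := stateAfter_counter_nat hD s x c S i j
    rw [hk]; positivity
  have h := (hS i).le_sum_removed hD
    (fun j => afterFill_counter_nat hD _ _ _ _ (stateAfter_counter_nat hD s x c S i j))
    (arrivals_le_card_urgent hD hs x hc i hnn) hcl
  have e : ∑ j, (stateAfter D s x c S (i + 1)).counter j =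
      ∑ j, (stateAfter D s x c S i).counter j + (1 + 1 / (D : ℝ)) * arrivals D s x c i -
      ∑ j ∈ S (i + 1), min (1 + 2 / (D : ℝ))
        ((afterFill D s x c i (stateAfter D s x c S i)).counter j) := by
    simp only [stateAfter, afterEmpty_counter]
    rw [Finset.sum_sub_distrib, Finset.sum_ite_mem, Finset.univ_inter]
    congr 1
    simp only [afterFill, arrivals]
    push_cast
    rw [Finset.sum_add_distrib, Finset.mul_sum]
  rw [e]
  linarith

/-- The one-step drift is summed. Since `arrivals … i` refers to step `i + 1`, the interval `Ico u
v` stands for the steps `u + 1, …, v`. -/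
theorem sum_counter_le_of_not_clear {n D p : ℕ} (hD : 1 ≤ D) {s : Fin n → ℕ → ℝ}
    (hs : ∀ j q, s j q ∈ Set.Ioc (0 : ℝ) 1) (x : Fin n → ℝ)
    {c : ℕ → Fin n → ℝ} (hc : ∀ i j, c i j ≤ 1) {S : ℕ → Finset (Fin n)}
    (hS : FollowsSmoothedGreedy D p s x c S) {u v : ℕ} (huv : u ≤ v)
    (hcl : ∀ i, u < i → i ≤ v → ¬ (stateAfter D s x c S i).IsClear) :
    (1 / D : ℝ) * (v - u) ≤ ∑ j, (stateAfter D s x c S u).counter j +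
      2 * ∑ i ∈ Finset.Ico u v, ((arrivals D s x c i - p : ℕ) : ℝ) := by
  suffices h : ∑ j, (stateAfter D s x c S v).counter j + (1 / D : ℝ) * (v - u) ≤
      ∑ j, (stateAfter D s x c S u).counter j +
      2 * ∑ i ∈ Finset.Ico u v, ((arrivals D s x c i - p : ℕ) : ℝ) by
    have hnn : 0 ≤ ∑ j, (stateAfter D s x c S v).counter j := Finset.sum_nonneg fun j _ => by
      obtain ⟨k, hk⟩ := stateAfter_counter_nat hD s x c S v j
      rw [hk]; positivity
    linarith
  induction v, huv using Nat.le_induction with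
  | base => simp
  | succ v huv ih =>
    have h1 := ih fun i h h' => hcl i h (h'.trans (Nat.le_succ v))
    have h2 := sum_counter_succ_le hD hs x hc hS (hcl (v + 1) (by omega) le_rfl)
    rw [Finset.sum_Ico_succ_top huv]
    push_cast
    linarith

theorem sum_counter_zero_le {n D : ℕ} (hD : 1 ≤ D) {s : Fin n → ℕ → ℝ}
    (hs : ∀ j q, s j q ∈ Set.Ioc (0 : ℝ) 1) {x : Fin n → ℝ} (hx : ∀ j, 0 ≤ x j)
    (c : ℕ → Fin n → ℝ) (S : ℕ → Finset (Fin n)) :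
    ∑ j, (stateAfter D s x c S 0).counter j ≤ ∑ j, x j :=
  Finset.sum_le_sum fun j _ => counter_le_total hD (hs j) (hx j)

/-- The last time before `i` at which all counters are zero is recent, or there were many more
arrivals than expected. -/
theorem recently_clear_or_excess {n D p : ℕ} (hD : 1 ≤ D) {s : Fin n → ℕ → ℝ}
    (hs : ∀ j q, s j q ∈ Set.Ioc (0 : ℝ) 1) {x : Fin n → ℝ} (hx : ∀ j, 0 ≤ x j)
    {c : ℕ → Fin n → ℝ} (hc : ∀ i j, c i j ≤ 1) {S : ℕ → Finset (Fin n)}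
    (hS : FollowsSmoothedGreedy D p s x c S) {i : ℕ} (hi : 2 * (∑ j, x j) ≤ 1 / D * i) (T : ℕ) :
    (1 / (4 * D) * i ≤ ∑ t ∈ Finset.Ico 0 i, ((arrivals D s x c t - p : ℕ) : ℝ)) ∨
    (∃ u, u + T < i ∧
      1 / (4 * D) * ((i : ℝ) - u) ≤
        ∑ t ∈ Finset.Ico u i, ((arrivals D s x c t - p : ℕ) : ℝ)) ∨
    ∃ u ≤ i, i ≤ u + T ∧ (stateAfter D s x c S u).IsClear := by
  have e : 1 / (4 * (D : ℝ)) = 1 / D / 4 := by field_simp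
  have hδ : 0 ≤ 1 / (D : ℝ) := by positivity
  rw [e]
  by_cases h : ∃ u ≤ i, (stateAfter D s x c S u).IsClear
  · obtain ⟨u, ⟨hui, hu⟩, hmax⟩ : ∃ u, (u ≤ i ∧ (stateAfter D s x c S u).IsClear) ∧
        ∀ t, u < t → t ≤ i → ¬ (stateAfter D s x c S t).IsClear := by
      classical
      obtain ⟨u, hu⟩ := h
      refine ⟨Nat.findGreatest (fun t => (stateAfter D s x c S t).IsClear) i,
        ⟨Nat.findGreatest_le i,
          Nat.findGreatest_spec (P := fun t => (stateAfter D s x c S t).IsClear) hu.1 hu.2⟩,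
        fun t h1 h2 => ?_⟩
      exact Nat.findGreatest_is_greatest h1 h2
    rcases Nat.lt_or_ge (u + T) i with hlt | hge
    · refine Or.inr (Or.inl ⟨u, hlt, ?_⟩)
      have h1 := sum_counter_le_of_not_clear hD hs x hc hS hui hmax
      rw [Finset.sum_eq_zero fun j _ => hu j] at h1
      have h2 : (u : ℝ) ≤ i := by exact_mod_cast hui
      have h3 := mul_nonneg hδ (sub_nonneg.2 h2)
      linarith
    · exact Or.inr (Or.inr ⟨u, hui, hge, hu⟩)
  · push Not at h
    left
    -- With no clear state at all, the initial counters use up at most `i / (2D)` of the drift `i /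
    -- D`. The rest is at most twice the total excess.
    have h1 := sum_counter_le_of_not_clear hD hs x hc hS (Nat.zero_le i) fun t _ ht => h t ht
    have h2 := sum_counter_zero_le hD hs hx c S
    push_cast at h1
    linarith

/-! ### Exponential moments under one-sided oscillation bounds -/

open MeasureTheory

theorem exp_le_one_add_sq {x : ℝ} (hx : |x| ≤ 1) : Real.exp x ≤ 1 + x + x ^ 2 := by
  have := (abs_le.1 (Real.abs_exp_sub_one_sub_id_le hx)).2
  linarith

/-- The exponential moment of a bounded function `f` of one random variable, if `f` exceeds its
other values by at most `g`. -/
theorem integral_exp_le_of_osc {ν : Measure ℝ} [IsProbabilityMeasure ν] {f g : ℝ → ℝ}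
    {K D Δ l : ℝ} (hf : Measurable f) (hg : Measurable g) (hfK : ∀ u, |f u| ≤ K)
    (hg0 : ∀ u, 0 ≤ g u) (hgD : ∀ u, g u ≤ D) (hgΔ : ∫ u, g u ∂ν ≤ Δ)
    (hosc : ∀ u v, f u ≤ f v + g u) (hl : 0 ≤ l) (hlD : l * D ≤ 1) :
    ∫ u, Real.exp (l * f u) ∂ν ≤ Real.exp (l * ∫ u, f u ∂ν + 2 * l ^ 2 * D * Δ) := by
  have hfi : Integrable f ν := Integrable.of_bound hf.aestronglyMeasurable K
    (Filter.Eventually.of_forall fun u => hfK u)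
  have hgi : Integrable g ν := Integrable.of_bound hg.aestronglyMeasurable D
    (Filter.Eventually.of_forall fun u => by
      rw [Real.norm_eq_abs, abs_of_nonneg (hg0 u)]
      exact hgD u)
  have hD0 : 0 ≤ D := (hg0 0).trans (hgD 0)
  set m := ∫ u, f u ∂ν with hm
  set G := ∫ u, g u ∂ν with hG
  have hG0 : 0 ≤ G := integral_nonneg hg0
  have hGD : G ≤ D := by
    have := integral_mono hgi (integrable_const D) hgD
    simpa using this
  -- Averaging the oscillation bound over `v` bounds `f` above its mean by `g`; averaging over the
  -- new value bounds it below by the mean `G` of `g`.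
  have h1 : ∀ u, f u - m ≤ g u := fun u => by
    have := integral_mono (μ := ν) (integrable_const (f u - g u)) hfi
      (fun v => by have := hosc u v; simp only; linarith)
    simp only [integral_const, probReal_univ, one_smul] at this
    linarith
  have h2 : ∀ u, m - f u ≤ G := fun u => by
    have := integral_mono (μ := ν) hfi ((integrable_const (f u)).add hgi)
      (fun v => by have := hosc v u; simp only [Pi.add_apply]; linarith)
    simp only [Pi.add_apply] at this
    rw [integral_add (integrable_const _) hgi] at this
    simp only [integral_const, probReal_univ, one_smul] at this
    linarith
  have h3 : ∀ u, Real.exp (l * (f u - m)) ≤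
      1 + l * (f u - m) + l ^ 2 * (D * (g u + G)) := fun u => by
    have habs : |f u - m| ≤ D := abs_le.2 ⟨by linarith [h2 u], by linarith [h1 u, hgD u]⟩
    -- Only one factor is bounded by `D`, so the variance is at most `2 D G` instead of `D ^ 2`.
    -- This keeps the final bound independent of the number of variables.
    have hsq : (f u - m) ^ 2 ≤ D * (g u + G) := by
      have habs' : |f u - m| ≤ g u + G :=
        abs_le.2 ⟨by linarith [h2 u, hg0 u], by linarith [h1 u]⟩
      rw [← sq_abs, sq]
      exact mul_le_mul habs habs' (abs_nonneg _) hD0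
    have hle : |l * (f u - m)| ≤ 1 := by
      rw [abs_mul, abs_of_nonneg hl]
      exact (mul_le_mul_of_nonneg_left habs hl).trans hlD
    have h4 := exp_le_one_add_sq hle
    have h5 : (l * (f u - m)) ^ 2 ≤ l ^ 2 * (D * (g u + G)) := by
      rw [mul_pow]
      exact mul_le_mul_of_nonneg_left hsq (sq_nonneg l)
    linarith
  have hi1 : Integrable (fun u => 1 + l * (f u - m)) ν :=
    (integrable_const 1).add ((hfi.sub (integrable_const m)).const_mul l)
  have hi2 : Integrable (fun u => l ^ 2 * (D * (g u + G))) ν :=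
    ((hgi.add (integrable_const G)).const_mul D).const_mul _
  have h6 : ∫ u, Real.exp (l * (f u - m)) ∂ν ≤ 1 + 2 * l ^ 2 * D * Δ := by
    calc ∫ u, Real.exp (l * (f u - m)) ∂ν
        ≤ ∫ u, (1 + l * (f u - m) + l ^ 2 * (D * (g u + G))) ∂ν := by
          refine integral_mono_of_nonneg (Filter.Eventually.of_forall fun u => (Real.exp_pos _).le)
            (hi1.add hi2) (Filter.Eventually.of_forall h3)
      _ = 1 + l ^ 2 * (D * (G + G)) := by
          have hi3 : ∫ u, (1 + l * (f u - m)) ∂ν = 1 := by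
            have hi4 : Integrable (fun u => l * (f u - m)) ν :=
              (hfi.sub (integrable_const m)).const_mul l
            rw [integral_add (integrable_const _) hi4, integral_const_mul,
              integral_sub hfi (integrable_const m)]
            simp [← hm]
          rw [integral_add hi1 hi2, hi3, integral_const_mul, integral_const_mul,
            integral_add hgi (integrable_const G)]
          simp [← hG]
      _ ≤ 1 + 2 * l ^ 2 * D * Δ := by
          have : l ^ 2 * D * G ≤ l ^ 2 * D * Δ :=
            mul_le_mul_of_nonneg_left hgΔ (by positivity)
          linarith
  have h7 : ∀ u, Real.exp (l * f u) = Real.exp (l * m) * Real.exp (l * (f u - m)) := fun u => by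
    rw [← Real.exp_add]; congr 1; ring
  simp_rw [h7]
  rw [integral_const_mul, Real.exp_add]
  refine mul_le_mul_of_nonneg_left (h6.trans ?_) (Real.exp_pos _).le
  linarith [Real.add_one_le_exp (2 * l ^ 2 * D * Δ)]

/-- The exponential moment of a function `F` of independent random variables whose value rises
by at most `g a u` when the variable with index `a` is set to `u`. -/
theorem integral_exp_pi_le_of_osc {ν : Measure ℝ} [IsProbabilityMeasure ν] {K D l : ℝ}
    (hl : 0 ≤ l) (hlD : l * D ≤ 1) : ∀ (N : ℕ) (F : (Fin N → ℝ) → ℝ) (g : Fin N → ℝ → ℝ)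
    (Δ : Fin N → ℝ), Measurable F → (∀ a, Measurable (g a)) → (∀ z, |F z| ≤ K) →
    (∀ a u, 0 ≤ g a u) → (∀ a u, g a u ≤ D) → (∀ a, ∫ u, g a u ∂ν ≤ Δ a) →
    (∀ z a u, F (Function.update z a u) ≤ F z + g a u) →
    ∫ z, Real.exp (l * F z) ∂(Measure.pi fun _ => ν) ≤
      Real.exp (l * ∫ z, F z ∂(Measure.pi fun _ => ν) + 2 * l ^ 2 * D * ∑ a, Δ a) := by
  intro N
  induction N with
  | zero =>
    intro F g Δ _ _ _ _ _ _ _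
    rw [Measure.pi_of_empty _ (fun a => a.elim0)]
    simp
  | succ N ih =>
    intro F g Δ hF hg hFK hg0 hgD hgΔ hosc
    have hmp := measurePreserving_piFinSuccAbove (fun _ : Fin (N + 1) => ν) 0
    have hsymm : ∀ w : ℝ × (Fin N → ℝ), (MeasurableEquiv.piFinSuccAbove
        (fun _ : Fin (N + 1) => ℝ) 0).symm w = (Fin.cons w.1 w.2 : Fin (N + 1) → ℝ) := fun w => by
      rw [← Fin.insertNth_zero']
      rfl
    have hchange : ∀ h : (Fin (N + 1) → ℝ) → ℝ, ∫ z, h z ∂(Measure.pi fun _ => ν) =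
        ∫ w : ℝ × (Fin N → ℝ), h (Fin.cons w.1 w.2) ∂(ν.prod (Measure.pi fun _ => ν)) := by
      intro h
      have := (hmp.symm).integral_comp' (g := h)
      simp only [hsymm] at this
      exact this.symm
    have hcons : Measurable fun w : ℝ × (Fin N → ℝ) => (Fin.cons w.1 w.2 : Fin (N + 1) → ℝ) := by
      have := (MeasurableEquiv.piFinSuccAbove (fun _ : Fin (N + 1) => ℝ) 0).symm.measurable
      rwa [funext hsymm] at this
    have hFc : Measurable fun w : ℝ × (Fin N → ℝ) => F (Fin.cons w.1 w.2) := hF.comp hcons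
    have hFc' : ∀ y, Measurable fun u => F (Fin.cons u y) := fun y =>
      hFc.comp (measurable_id.prodMk measurable_const)
    have hFi : ∀ y, Integrable (fun u => F (Fin.cons u y)) ν := fun y =>
      Integrable.of_bound (hFc' y).aestronglyMeasurable K
        (Filter.Eventually.of_forall fun u => hFK _)
    set F' : (Fin N → ℝ) → ℝ := fun y => ∫ u, F (Fin.cons u y) ∂ν with hF'
    have hF'm : Measurable F' := by
      exact (hFc.stronglyMeasurable.integral_prod_left (μ := ν)).measurable
    have hF'K : ∀ y, |F' y| ≤ K := fun y => by
      have := norm_integral_le_of_norm_le_const (μ := ν) (f := fun u => F (Fin.cons u y))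
        (Filter.Eventually.of_forall fun u => hFK _)
      simpa using this
    -- Integrating out the first coordinate preserves the oscillation bounds, because `g a u` does
    -- not involve the other coordinates.
    have hih := ih F' (fun a => g a.succ) (fun a => Δ a.succ) hF'm (fun a => hg _) hF'K
      (fun a => hg0 _) (fun a => hgD _) (fun a => hgΔ _) (fun y a u => by
        simp only [hF']
        have h1 := integral_mono (hFi (Function.update y a u))
          ((hFi y).add (integrable_const (g a.succ u))) (fun v => by
            have := hosc (Fin.cons v y) a.succ u
            rw [← Fin.cons_update] at this
            exact this)
        simp only [Pi.add_apply] at h1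
        rw [integral_add (hFi y) (integrable_const _)] at h1
        simpa using h1)
    have hbound : ∀ z, |Real.exp (l * F z)| ≤ Real.exp (l * K) := fun z => by
      rw [abs_of_pos (Real.exp_pos _)]
      exact Real.exp_le_exp.2 (mul_le_mul_of_nonneg_left ((le_abs_self _).trans (hFK z)) hl)
    have hei : Integrable (fun w : ℝ × (Fin N → ℝ) => Real.exp (l * F (Fin.cons w.1 w.2)))
        (ν.prod (Measure.pi fun _ => ν)) :=
      Integrable.of_bound (Real.measurable_exp.comp (hFc.const_mul l)).aestronglyMeasurable
        (Real.exp (l * K)) (Filter.Eventually.of_forall fun w => hbound _)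
    have hFint : Integrable (fun w : ℝ × (Fin N → ℝ) => F (Fin.cons w.1 w.2))
        (ν.prod (Measure.pi fun _ => ν)) :=
      Integrable.of_bound hFc.aestronglyMeasurable K (Filter.Eventually.of_forall fun w => hFK _)
    rw [hchange, hchange, integral_prod_symm _ hei, integral_prod_symm _ hFint]
    change _ ≤ Real.exp (l * ∫ y, F' y ∂_ + _)
    have hF'b : ∀ y, Real.exp (l * F' y) ≤ Real.exp (l * K) := fun y =>
      Real.exp_le_exp.2 (mul_le_mul_of_nonneg_left ((le_abs_self _).trans (hF'K y)) hl)
    have hexpi : Integrable (fun y => Real.exp (l * F' y)) (Measure.pi fun _ : Fin N => ν) :=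
      Integrable.of_bound (Real.measurable_exp.comp (hF'm.const_mul l)).aestronglyMeasurable
        (Real.exp (l * K)) (Filter.Eventually.of_forall fun y => by
          rw [Real.norm_eq_abs, abs_of_pos (Real.exp_pos _)]; exact hF'b y)
    calc ∫ y, ∫ u, Real.exp (l * F (Fin.cons u y)) ∂ν ∂(Measure.pi fun _ => ν)
        ≤ ∫ y, Real.exp (l * F' y) * Real.exp (2 * l ^ 2 * D * Δ 0) ∂(Measure.pi fun _ => ν) := by
          refine integral_mono hei.integral_prod_right (hexpi.mul_const _) fun y => ?_
          simp only
          rw [← Real.exp_add]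
          refine integral_exp_le_of_osc (hFc' y) (hg 0) (fun u => hFK _) (hg0 0) (hgD 0) (hgΔ 0)
            (fun u v => ?_) hl hlD
          have := hosc (Fin.cons v y) 0 u
          rwa [Fin.update_cons_zero] at this
      _ = (∫ y, Real.exp (l * F' y) ∂(Measure.pi fun _ => ν)) *
            Real.exp (2 * l ^ 2 * D * Δ 0) := integral_mul_const _ _
      _ ≤ _ := by
          refine (mul_le_mul_of_nonneg_right hih (Real.exp_pos _).le).trans ?_
          rw [← Real.exp_add, Fin.sum_univ_succ]
          exact (congrArg Real.exp (by ring)).le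

/-! ### The exponential potential after a clear state -/

/-- The weight of a cup with fill `h`. -/
noncomputable def weight (ε h : ℝ) : ℝ := max (Real.exp (ε * (h - 8))) 1

theorem weight_mono {ε : ℝ} (hε : 0 ≤ ε) : Monotone (weight ε) := fun a b hab =>
  max_le_max (Real.exp_le_exp.2 (by gcongr)) le_rfl

theorem one_le_weight (ε h : ℝ) : 1 ≤ weight ε h := le_max_right _ _

theorem exp_le_weight (ε h : ℝ) : Real.exp (ε * (h - 8)) ≤ weight ε h := le_max_left _ _

theorem weight_of_le {ε h : ℝ} (hε : 0 ≤ ε) (hh : h ≤ 8) : weight ε h = 1 :=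
  max_eq_right (Real.exp_le_one_iff.2 (mul_nonpos_of_nonneg_of_nonpos hε (by linarith)))

theorem weight_of_ge {ε h : ℝ} (hε : 0 ≤ ε) (hh : 8 ≤ h) :
    weight ε h = Real.exp (ε * (h - 8)) :=
  max_eq_left (Real.one_le_exp (mul_nonneg hε (by linarith)))

theorem weight_add_le {ε h y M : ℝ} (hε : 0 ≤ ε) (hy : 0 ≤ y) (hM : h + y ≤ M) :
    weight ε (h + y) ≤ weight ε h + y * (ε * weight ε M) := by
  have hw : 0 ≤ weight ε M := zero_le_one.trans (one_le_weight ε M)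
  rcases le_total (h + y) 8 with h8 | h8
  · rw [weight_of_le hε h8]
    have := one_le_weight ε h
    have : 0 ≤ y * (ε * weight ε M) := by positivity
    linarith
  · have h1 := weight_mono hε hM
    have h2 : weight ε (h + y) - y * (ε * weight ε (h + y)) ≤ weight ε h := by
      refine le_trans ?_ (exp_le_weight ε h)
      rw [weight_of_ge hε h8]
      have h3 := Real.add_one_le_exp (-(ε * y))
      have h4 := mul_le_mul_of_nonneg_left h3 (Real.exp_pos (ε * (h + y - 8))).le
      rw [← Real.exp_add] at h4
      rw [show ε * (h - 8) = ε * (h + y - 8) + -(ε * y) by ring]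
      linarith
    have h3 : y * (ε * weight ε (h + y)) ≤ y * (ε * weight ε M) := by gcongr
    linarith

theorem weight_sub_le {ε g y M : ℝ} (hε : 0 ≤ ε) (hy : y ≤ 1) (hM : M ≤ g) (hM9 : 9 ≤ M) :
    weight ε (g - 1) + (1 - y) * (ε * weight ε (M - 1)) ≤ weight ε (g - y) := by
  have h1 : weight ε (M - 1) ≤ weight ε (g - 1) := weight_mono hε (by linarith)
  have h2 : (1 - y) * (ε * weight ε (M - 1)) ≤ (1 - y) * (ε * weight ε (g - 1)) := by
    have : 0 ≤ 1 - y := by linarith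
    gcongr
  refine le_trans ?_ (exp_le_weight ε (g - y))
  rw [weight_of_ge hε (show 8 ≤ g - 1 by linarith)] at h2 ⊢
  have h3 := Real.add_one_le_exp (ε * (1 - y))
  have h4 := mul_le_mul_of_nonneg_left h3 (Real.exp_pos (ε * (g - 1 - 8))).le
  rw [← Real.exp_add] at h4
  rw [show ε * (g - y - 8) = ε * (g - 1 - 8) + ε * (1 - y) by ring]
  linarith

/-- The slack `1 - ε` of the filler pays for comparing the rate of gain at level `M` with the rate
of loss at level `M - 1`. -/
theorem weight_sub_one {ε M : ℝ} (hε : 0 ≤ ε) (hM9 : 9 ≤ M) :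
    (1 - ε) * weight ε M ≤ weight ε (M - 1) := by
  rw [weight_of_ge hε (by linarith), weight_of_ge hε (by linarith)]
  have h3 := Real.add_one_le_exp (-ε)
  have h4 := mul_le_mul_of_nonneg_left h3 (Real.exp_pos (ε * (M - 8))).le
  rw [← Real.exp_add] at h4
  rw [show ε * (M - 1 - 8) = ε * (M - 8) + -ε by ring]
  linarith

/-- The total weight, beyond one per cup, of a configuration. -/
noncomputable def State.excessWeight {n : ℕ} (ε : ℝ) (σ : State n) : ℝ :=
  ∑ j, (weight ε (σ.fill j) - 1)

/-- One step of the greedy algorithm increases the excess weight only slightly. -/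
theorem IsGreedyChoice.excessWeight_le {n D p : ℕ} {ε : ℝ} (hD : 1 ≤ D) (hε : 0 ≤ ε)
    (hε2 : ε ≤ 1 / 2) {y h : Fin n → ℝ} (hy0 : ∀ j, 0 ≤ y j) (hy1 : ∀ j, y j ≤ 1)
    (hy : ∑ j, y j ≤ (1 - ε) * p) {σ : State n} (hσ : ∀ j, σ.fill j = h j + y j)
    (hfill : ∀ j, σ.fill j ≤ σ.counter j + 4) (hw0 : ∀ j, 0 ≤ σ.counter j)
    {S : Finset (Fin n)} (hS : IsGreedyChoice D p σ S) :
    (afterEmpty D S σ).excessWeight ε ≤ ∑ j, (weight ε (h j) - 1) + 2 * p := by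
  classical
  have hδ0 : 0 ≤ 1 / (D : ℝ) := by positivity
  have hδ1 : 1 / (D : ℝ) ≤ 1 := by
    rw [div_le_one (by exact_mod_cast hD)]; exact_mod_cast hD
  have h2δ : 2 / (D : ℝ) = 2 * (1 / D) := by ring
  have hin : ∀ j ∈ S, 6 ≤ σ.fill j → (afterEmpty D S σ).fill j ≤ σ.fill j - 1 := by
    intro j hj h6
    rw [afterEmpty_fill, if_pos hj]
    have : 1 ≤ min (1 + 2 / (D : ℝ)) (σ.counter j) :=
      le_min (by linarith) (by linarith [hfill j])
    linarith
  have hin' : ∀ j ∈ S, weight ε ((afterEmpty D S σ).fill j) ≤ weight ε (h j) := by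
    intro j hj
    rcases le_total 6 (σ.fill j) with h6 | h6
    · refine weight_mono hε ((hin j hj h6).trans ?_)
      rw [hσ]
      linarith [hy1 j]
    · have : (afterEmpty D S σ).fill j ≤ σ.fill j := by
        rw [afterEmpty_fill, if_pos hj]
        have : 0 ≤ min (1 + 2 / (D : ℝ)) (σ.counter j) := le_min (by linarith) (hw0 j)
        linarith
      rw [weight_of_le hε (by linarith)]
      exact one_le_weight _ _
  have hout : ∀ j ∉ S, (afterEmpty D S σ).fill j = h j + y j := by
    intro j hj
    rw [afterEmpty_fill, if_neg hj, sub_zero, hσ]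
  unfold State.excessWeight
  rw [Finset.sum_sub_distrib, Finset.sum_sub_distrib,
    ← Finset.sum_add_sum_compl S (fun j => weight ε ((afterEmpty D S σ).fill j)),
    ← Finset.sum_add_sum_compl S (fun j => weight ε (h j))]
  rw [← Finset.sum_add_sum_compl S] at hy
  have hyin : 0 ≤ ∑ j ∈ S, y j := Finset.sum_nonneg fun j _ => hy0 j
  have hp0 : (0 : ℝ) ≤ p := Nat.cast_nonneg p
  have houtsum : ∀ M : ℝ, (∀ j ∉ S, σ.fill j ≤ M) →
      ∑ j ∈ Sᶜ, weight ε ((afterEmpty D S σ).fill j) ≤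
        ∑ j ∈ Sᶜ, weight ε (h j) + (∑ j ∈ Sᶜ, y j) * (ε * weight ε M) := by
    intro M hM
    rw [Finset.sum_mul, ← Finset.sum_add_distrib]
    refine Finset.sum_le_sum fun j hj => ?_
    have hj := Finset.mem_compl.1 hj
    rw [hout j hj]
    refine weight_add_le hε (hy0 j) ?_
    rw [← hσ]
    exact hM j hj
  have hinsum := Finset.sum_le_sum hin'
  -- Above level 9 the fill minus 1 is still in the exponential range of the weight, and the counter
  -- is at least 5, hence of top priority. Below it, the unselected cups gain at most one unit of
  -- weight per unit of water.
  by_cases hsmall : ∀ j ∉ S, σ.fill j ≤ 9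
  · have h1 := houtsum 9 hsmall
    have h2 : weight ε 9 ≤ 2 := by
      rw [weight_of_ge hε (by norm_num)]
      have := exp_le_one_add_sq (x := ε * (9 - 8))
        (by rw [abs_of_nonneg (by linarith)]; linarith)
      nlinarith
    have h3 : ε * weight ε 9 ≤ 1 := by
      have := one_le_weight ε 9
      nlinarith
    have hyo : 0 ≤ ∑ j ∈ Sᶜ, y j := Finset.sum_nonneg fun j _ => hy0 j
    have h4 : (∑ j ∈ Sᶜ, y j) * (ε * weight ε 9) ≤ ∑ j ∈ Sᶜ, y j :=
      mul_le_of_le_one_right hyo h3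
    nlinarith
  · push Not at hsmall
    obtain ⟨j₀, hj₀, hj₀9⟩ := hsmall
    obtain ⟨j₁, hj₁, hmax⟩ := Finset.exists_max_image Sᶜ σ.fill ⟨j₀, Finset.mem_compl.2 hj₀⟩
    have hj₁S := Finset.mem_compl.1 hj₁
    set M := σ.fill j₁ with hM
    have hM9 : 9 ≤ M := hj₀9.le.trans (hmax j₀ (Finset.mem_compl.2 hj₀))
    -- The fullest unselected cup has top priority, so all selected cups share that level and are at
    -- least as full.
    have hge : ∀ j ∈ S, M ≤ σ.fill j := by
      intro j hj
      have hpr : priority D (σ.counter j₁) = 2 :=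
        priority_eq_two.2 (by linarith [hfill j₁])
      rcases hS.greedy j hj j₁ hj₁S with hlt | hle
      · rw [hpr] at hlt
        exact absurd (priority_le_two D (σ.counter j)) (not_le.2 hlt)
      · exact hle.2
    have h1 := houtsum M fun j hj => hmax j (Finset.mem_compl.2 hj)
    have h2 : ∑ j ∈ S, weight ε ((afterEmpty D S σ).fill j) +
        (∑ j ∈ S, (1 - y j)) * (ε * weight ε (M - 1)) ≤ ∑ j ∈ S, weight ε (h j) := by
      rw [Finset.sum_mul, ← Finset.sum_add_distrib]
      refine Finset.sum_le_sum fun j hj => ?_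
      have h3 := weight_sub_le hε (hy1 j) (hge j hj) hM9
      rw [show σ.fill j - y j = h j by rw [hσ]; ring] at h3
      have h4 := weight_mono hε (hin j hj (by linarith [hge j hj]))
      linarith
    have hcard : (S.card : ℝ) = p + 1 := by
      have h3 := Finset.card_lt_univ_of_notMem hj₁S
      rw [Fintype.card_fin] at h3
      have h4 := hS.card_eq
      have : S.card = p + 1 := by omega
      rw [this]; push_cast; ring
    rw [Finset.sum_sub_distrib, Finset.sum_const, nsmul_eq_mul, mul_one, hcard] at h2
    have h3 := weight_sub_one hε hM9
    have hW := one_le_weight ε M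
    have hyp : ∑ j ∈ S, y j ≤ p := by
      have hyo : 0 ≤ ∑ j ∈ Sᶜ, y j := Finset.sum_nonneg fun j _ => hy0 j
      nlinarith
    have h4 : (∑ j ∈ Sᶜ, y j) * (ε * weight ε M) ≤
        (p + 1 - ∑ j ∈ S, y j) * (ε * weight ε (M - 1)) := by
      -- Moving the water poured into `S` to the other side costs nothing, since it is nonnegative
      -- and `1 - ε ≤ 1`. The gain outside `S` is then at most the loss inside.
      have h5 : (∑ j ∈ Sᶜ, y j) ≤ (p + 1 - ∑ j ∈ S, y j) * (1 - ε) := by nlinarith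
      calc (∑ j ∈ Sᶜ, y j) * (ε * weight ε M)
          ≤ (p + 1 - ∑ j ∈ S, y j) * (1 - ε) * (ε * weight ε M) := by gcongr
        _ = (p + 1 - ∑ j ∈ S, y j) * (ε * ((1 - ε) * weight ε M)) := by ring
        _ ≤ _ := by
            have : 0 ≤ p + 1 - ∑ j ∈ S, y j := by linarith
            gcongr
    linarith

theorem excessWeight_stateAfter_le {n D p : ℕ} {ε : ℝ} (hD : 1 ≤ D) (hε : 0 ≤ ε)
    (hε2 : ε ≤ 1 / 2) {s : Fin n → ℕ → ℝ}
    (hs : ∀ j q, s j q ∈ Set.Ioc (0 : ℝ) 1) {x : Fin n → ℝ} (hx : ∀ j, 0 ≤ x j)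
    {c : ℕ → Fin n → ℝ} (hc : IsFiller p ε c) {S : ℕ → Finset (Fin n)}
    (hS : FollowsSmoothedGreedy D p s x c S) {u : ℕ}
    (hu : (stateAfter D s x c S u).IsClear) (r : ℕ) :
    (stateAfter D s x c S (u + r)).excessWeight ε ≤ 2 * p * r := by
  induction r with
  | zero =>
    simp only [add_zero, Nat.cast_zero, mul_zero]
    refine Finset.sum_nonpos fun j _ => ?_
    have := fill_le_counter_add hD hs hx hc.nonneg S u j
    rw [hu j] at this
    rw [weight_of_le hε (by linarith), sub_self]
  | succ r ih =>
    have hnn : ∀ j, 0 ≤ (stateAfter D s x c S (u + r)).counter j := fun j => by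
      obtain ⟨k, hk⟩ := stateAfter_counter_nat hD s x c S (u + r) j
      rw [hk]; positivity
    have h := (hS (u + r)).excessWeight_le hD hε hε2 (hc.nonneg (u + r + 1))
      (hc.le_one (u + r + 1)) (hc.sum_le (u + r + 1))
      (h := (stateAfter D s x c S (u + r)).fill) (fun j => rfl)
      (fun j => by
        have h1 := fill_le_counter_add hD hs hx hc.nonneg S (u + r) j
        have h2 := hc.le_one (u + r + 1) j
        have h3 : 0 ≤ (1 + 1 / (D : ℝ)) *
            crossings D (s j) (total x c (u + r) j) (total x c (u + r + 1) j) := by positivity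
        simp only [afterFill]
        linarith)
      (fun j => by
        have h3 : 0 ≤ (1 + 1 / (D : ℝ)) *
            crossings D (s j) (total x c (u + r) j) (total x c (u + r + 1) j) := by positivity
        simp only [afterFill]
        linarith [hnn j])
    push_cast
    calc _ ≤ _ := h
      _ ≤ 2 * p * r + 2 * p := by gcongr; exact ih
      _ = _ := by ring

theorem backlog_le_of_clear {n D p : ℕ} {ε : ℝ} (hD : 1 ≤ D) (hε : 0 < ε)
    (hε2 : ε ≤ 1 / 2) {s : Fin n → ℕ → ℝ}
    (hs : ∀ j q, s j q ∈ Set.Ioc (0 : ℝ) 1) {x : Fin n → ℝ} (hx : ∀ j, 0 ≤ x j)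
    {c : ℕ → Fin n → ℝ} (hc : IsFiller p ε c) {S : ℕ → Finset (Fin n)}
    (hS : FollowsSmoothedGreedy D p s x c S) {u i T : ℕ} (hui : u ≤ i) (hiT : i ≤ u + T)
    (hu : (stateAfter D s x c S u).IsClear) :
    backlog (stateAfter D s x c S i).fill ≤ 8 + Real.log (1 + 2 * p * T) / ε := by
  have hpT : 0 ≤ (2 * p * T : ℝ) := by positivity
  refine Real.iSup_le (fun j => ?_)
    (add_nonneg (by norm_num) (div_nonneg (Real.log_nonneg (by linarith)) hε.le))
  obtain ⟨r, rfl⟩ := Nat.exists_eq_add_of_le hui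
  have h1 := excessWeight_stateAfter_le hD hε.le hε2 hs hx hc hS hu r
  have h2 := Finset.single_le_sum (f := fun j =>
    weight ε ((stateAfter D s x c S (u + r)).fill j) - 1)
    (fun j _ => sub_nonneg.2 (one_le_weight ε _)) (Finset.mem_univ j)
  have h3 : (2 * p * r : ℝ) ≤ 2 * p * T := by
    have : (r : ℝ) ≤ T := by exact_mod_cast (by omega : r ≤ T)
    gcongr
  have h4 : Real.exp (ε * ((stateAfter D s x c S (u + r)).fill j - 8)) ≤ 1 + 2 * p * T := by
    refine (exp_le_weight ε _).trans ?_
    unfold State.excessWeight at h1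
    linarith
  have h5 := (Real.le_log_iff_exp_le (by linarith)).2 h4
  rw [← sub_le_iff_le_add', le_div_iff₀ hε]
  linarith

theorem backlog_le_three_of_clear {n D : ℕ} (hD : 1 ≤ D) {s : Fin n → ℕ → ℝ}
    (hs : ∀ j q, s j q ∈ Set.Ioc (0 : ℝ) 1) {x : Fin n → ℝ} (hx : ∀ j, 0 ≤ x j)
    {c : ℕ → Fin n → ℝ} (hc : ∀ i j, 0 ≤ c i j) {S : ℕ → Finset (Fin n)} {i : ℕ}
    (hi : (stateAfter D s x c S i).IsClear) : backlog (stateAfter D s x c S i).fill ≤ 3 :=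
  Real.iSup_le (fun j => by
    have := fill_le_counter_add hD hs hx hc S i j
    rw [hi j] at this
    linarith) (by norm_num)

/-- After the counters have all been zero, they remain so until more than `p` thresholds are
crossed in one step. -/
theorem isClear_of_arrivals_le {n D p : ℕ} (hD : 1 ≤ D) {s : Fin n → ℕ → ℝ}
    (hs : ∀ j q, s j q ∈ Set.Ioc (0 : ℝ) 1) (x : Fin n → ℝ)
    {c : ℕ → Fin n → ℝ} (hc : ∀ i j, c i j ≤ 1) {S : ℕ → Finset (Fin n)}
    (hS : FollowsSmoothedGreedy D p s x c S) {u i : ℕ} (hui : u ≤ i)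
    (hN : ∀ t ∈ Finset.Ico u i, arrivals D s x c t ≤ p)
    (hu : (stateAfter D s x c S u).IsClear) : (stateAfter D s x c S i).IsClear := by
  induction i, hui using Nat.le_induction with
  | base => exact hu
  | succ i hui ih =>
    refine isClear_succ hD hs x hc hS (hN i (Finset.mem_Ico.2 ⟨hui, Nat.lt_succ_self i⟩))
      (ih fun t ht => hN t ?_)
    have := Finset.mem_Ico.1 ht
    exact Finset.mem_Ico.2 ⟨this.1, by omega⟩

/-! ### Excess over `p` of sums of independent indicators -/

theorem integrable_pi_of_natCast_le {ν : Measure ℝ} [IsProbabilityMeasure ν] {N K : ℕ}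
    {f : (Fin N → ℝ) → ℕ} (hf : Measurable f) (hK : ∀ z, f z ≤ K) :
    Integrable (fun z => (f z : ℝ)) (Measure.pi fun _ => ν) :=
  Integrable.of_bound (measurable_from_top.comp hf).aestronglyMeasurable K
    (Filter.Eventually.of_forall fun z => by
      rw [Real.norm_eq_abs, abs_of_nonneg (Nat.cast_nonneg _)]
      exact_mod_cast hK z)

theorem exp_mul_natCast_le {b : ℕ} (hb : b ≤ 1) (l : ℝ) :
    Real.exp (l * b) ≤ 1 + (Real.exp l - 1) * b := by
  interval_cases b <;> simp

theorem measurable_sum_pi {N : ℕ} {b : Fin N → ℝ → ℕ} (hbm : ∀ a, Measurable (b a)) :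
    Measurable fun z : Fin N → ℝ => ∑ a, b a (z a) :=
  Finset.measurable_sum _ fun a _ => (hbm a).comp (measurable_pi_apply a)

theorem sum_pi_le {N : ℕ} {b : Fin N → ℝ → ℕ} (hb : ∀ a u, b a u ≤ 1) (z : Fin N → ℝ) :
    ∑ a, b a (z a) ≤ N := by
  simpa using Finset.sum_le_card_nsmul Finset.univ (fun a => b a (z a)) 1 fun a _ => hb a (z a)

/-- The expected excess over `p` of a sum of independent indicators with mean at most
`(1 - ε) p`. -/
theorem integral_excess_le {ν : Measure ℝ} [IsProbabilityMeasure ν] {N p : ℕ} {ε : ℝ}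
    (hε : 0 < ε) (hε1 : ε ≤ 1) {b : Fin N → ℝ → ℕ} (hbm : ∀ a, Measurable (b a))
    (hb : ∀ a u, b a u ≤ 1) (hmean : ∑ a, ∫ u, (b a u : ℝ) ∂ν ≤ (1 - ε) * p) :
    ∫ z, ((∑ a, b a (z a) - p : ℕ) : ℝ) ∂(Measure.pi fun _ => ν) ≤
      2 / ε * Real.exp (-(ε ^ 2 * p / 4)) := by
  -- With this `l`, the Chernoff exponent `-l p + (l + l²)(1 - ε) p` is at most `-ε² p / 4`. The
  -- excess itself is bounded by `exp(l (M - p)) / l`.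
  set l := ε / 2 with hl
  have hl0 : 0 < l := by positivity
  have hbi : ∀ a, Integrable (fun u => (b a u : ℝ)) ν := fun a =>
    Integrable.of_bound (measurable_from_top.comp (hbm a)).aestronglyMeasurable 1
      (Filter.Eventually.of_forall fun u => by
        rw [Real.norm_eq_abs, abs_of_nonneg (Nat.cast_nonneg _)]
        exact_mod_cast hb a u)
  have hel : 0 ≤ Real.exp l - 1 := by linarith [Real.add_one_le_exp l]
  have h1 : ∀ a, ∫ u, Real.exp (l * b a u) ∂ν ≤
      Real.exp ((Real.exp l - 1) * ∫ u, (b a u : ℝ) ∂ν) := fun a => by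
    calc ∫ u, Real.exp (l * b a u) ∂ν ≤ ∫ u, (1 + (Real.exp l - 1) * b a u) ∂ν := by
          refine integral_mono_of_nonneg
            (Filter.Eventually.of_forall fun u => (Real.exp_pos _).le)
            ((integrable_const 1).add ((hbi a).const_mul _))
            (Filter.Eventually.of_forall fun u => exp_mul_natCast_le (hb a u) l)
      _ = 1 + (Real.exp l - 1) * ∫ u, (b a u : ℝ) ∂ν := by
          rw [integral_add (integrable_const _) ((hbi a).const_mul _), integral_const_mul]
          simp
      _ ≤ _ := by linarith [Real.add_one_le_exp ((Real.exp l - 1) * ∫ u, (b a u : ℝ) ∂ν)]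
  have h2 : ∫ z : Fin N → ℝ, ∏ a, Real.exp (l * b a (z a)) ∂(Measure.pi fun _ => ν) ≤
      Real.exp ((Real.exp l - 1) * ((1 - ε) * p)) := by
    rw [integral_fintype_prod_eq_prod (𝕜 := ℝ) (fun a (u : ℝ) => Real.exp (l * b a u))]
    refine (Finset.prod_le_prod (fun a _ => integral_nonneg fun u => (Real.exp_pos _).le)
      fun a _ => h1 a).trans ?_
    rw [← Real.exp_sum, ← Finset.mul_sum]
    exact Real.exp_le_exp.2 (mul_le_mul_of_nonneg_left hmean hel)
  have h3 : ∀ z : Fin N → ℝ, ((∑ a, b a (z a) - p : ℕ) : ℝ) ≤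
      1 / l * Real.exp (-(l * p)) * ∏ a, Real.exp (l * b a (z a)) := fun z => by
    rw [← Real.exp_sum, ← Finset.mul_sum, mul_assoc, ← Real.exp_add, ← Nat.cast_sum]
    set M := ∑ a, b a (z a)
    rcases Nat.le_total M p with h | h
    · rw [Nat.sub_eq_zero_of_le h, Nat.cast_zero]
      positivity
    · rw [Nat.cast_sub h, one_div, ← div_eq_inv_mul, le_div_iff₀ hl0]
      have := Real.add_one_le_exp (-(l * p) + l * M)
      linarith
  have hprod : Integrable (fun z : Fin N → ℝ => ∏ a, Real.exp (l * b a (z a)))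
      (Measure.pi fun _ => ν) := by
    refine Integrable.of_bound (Finset.measurable_prod _ fun a _ => Real.measurable_exp.comp
      ((measurable_from_top.comp ((hbm a).comp (measurable_pi_apply a))).const_mul
        l)).aestronglyMeasurable (Real.exp (l * N)) (Filter.Eventually.of_forall fun z => ?_)
    rw [← Real.exp_sum, ← Finset.mul_sum, ← Nat.cast_sum, Real.norm_eq_abs,
      abs_of_pos (Real.exp_pos _), Real.exp_le_exp]
    exact mul_le_mul_of_nonneg_left (by exact_mod_cast sum_pi_le hb z) hl0.le
  calc ∫ z, ((∑ a, b a (z a) - p : ℕ) : ℝ) ∂(Measure.pi fun _ => ν)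
      ≤ ∫ z : Fin N → ℝ, 1 / l * Real.exp (-(l * p)) * ∏ a, Real.exp (l * b a (z a))
          ∂(Measure.pi fun _ => ν) :=
        integral_mono_of_nonneg (Filter.Eventually.of_forall fun z => Nat.cast_nonneg _)
          (hprod.const_mul _) (Filter.Eventually.of_forall h3)
    _ ≤ 1 / l * Real.exp (-(l * p)) * Real.exp ((Real.exp l - 1) * ((1 - ε) * p)) := by
        rw [integral_const_mul]
        exact mul_le_mul_of_nonneg_left h2 (by positivity)
    _ ≤ 2 / ε * Real.exp (-(ε ^ 2 * p / 4)) := by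
        rw [mul_assoc, ← Real.exp_add, show 1 / l = 2 / ε by rw [hl, one_div_div]]
        refine mul_le_mul_of_nonneg_left (Real.exp_le_exp.2 ?_) (by positivity)
        have h4 : Real.exp l - 1 ≤ l + l ^ 2 := by
          have := exp_le_one_add_sq (x := l) (by rw [abs_of_pos hl0]; linarith)
          linarith
        have h5 : (0 : ℝ) ≤ (1 - ε) * p := mul_nonneg (by linarith) (Nat.cast_nonneg _)
        have h6 := mul_le_mul_of_nonneg_right h4 h5
        have h7 : (0 : ℝ) ≤ ε ^ 3 * p := by positivity
        rw [hl] at h6 ⊢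
        nlinarith

theorem measure_excess_pos_le {ν : Measure ℝ} [IsProbabilityMeasure ν] {N p : ℕ} {ε : ℝ}
    (hε : 0 < ε) (hε1 : ε ≤ 1) {b : Fin N → ℝ → ℕ} (hbm : ∀ a, Measurable (b a))
    (hb : ∀ a u, b a u ≤ 1) (hmean : ∑ a, ∫ u, (b a u : ℝ) ∂ν ≤ (1 - ε) * p) :
    (Measure.pi fun _ => ν) {z : Fin N → ℝ | p < ∑ a, b a (z a)} ≤
      ENNReal.ofReal (2 / ε * Real.exp (-(ε ^ 2 * p / 4))) := by
  have hm : Measurable fun z : Fin N → ℝ => ∑ a, b a (z a) - p :=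
    (measurable_sum_pi hbm).sub_const p
  have h := mul_meas_ge_le_integral_of_nonneg (μ := Measure.pi fun _ : Fin N => ν)
    (f := fun z => ((∑ a, b a (z a) - p : ℕ) : ℝ))
    (Filter.Eventually.of_forall fun z => Nat.cast_nonneg _)
    (integrable_pi_of_natCast_le hm fun z => (Nat.sub_le _ _).trans (sum_pi_le hb z)) 1
  rw [one_mul] at h
  have h2 := h.trans (integral_excess_le hε hε1 hbm hb hmean)
  rw [← ENNReal.ofReal_toReal (measure_ne_top _ _)]
  refine ENNReal.ofReal_le_ofReal (le_trans (le_of_eq ?_) h2)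
  rw [measureReal_def]
  congr 2
  ext z
  change p < _ ↔ (1 : ℝ) ≤ ((_ : ℕ) : ℝ)
  rw [Nat.one_le_cast]
  omega

/-- The total excess over `p` of sums of independent indicators rarely exceeds by far its
expectation, if each of the random variables contributes at most `D` units in all. -/
theorem measure_sum_excess_ge_le {ν : Measure ℝ} [IsProbabilityMeasure ν] {N p D : ℕ} {ε : ℝ}
    (hp : 1 ≤ p) (hD : 1 ≤ D) (hε : 0 < ε) (hε1 : ε ≤ 1) {b : Fin N → ℕ → ℝ → ℕ}
    (hbm : ∀ a t, Measurable (b a t)) (hb : ∀ a t u, b a t u ≤ 1)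
    (hmean : ∀ t, ∑ a, ∫ u, (b a t u : ℝ) ∂ν ≤ (1 - ε) * p) {W : Finset ℕ}
    (hbD : ∀ a u, ∑ t ∈ W, b a t u ≤ D)
    (hδ : 2 / ε * Real.exp (-(ε ^ 2 * p / 4)) ≤ 1 / (8 * D)) :
    (Measure.pi fun _ => ν) {z : Fin N → ℝ |
        1 / (4 * D) * (W.card : ℝ) ≤ ∑ t ∈ W, ((∑ a, b a t (z a) - p : ℕ) : ℝ)} ≤
      ENNReal.ofReal (Real.exp (-(W.card / (512 * p * D ^ 3)))) := by
  have hD0 : (1 : ℝ) ≤ D := by exact_mod_cast hD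
  have hp0 : (1 : ℝ) ≤ p := by exact_mod_cast hp
  set F : (Fin N → ℝ) → ℝ := fun z => ∑ t ∈ W, ((∑ a, b a t (z a) - p : ℕ) : ℝ) with hF
  -- This value maximizes `l / (8D) - 2 l² D p`, the exponent gained per step.
  set l : ℝ := 1 / (32 * p * D ^ 2) with hl
  have hl0 : 0 ≤ l := by positivity
  have hlD : l * D ≤ 1 := by
    rw [hl, div_mul_eq_mul_div, one_mul, div_le_one (by positivity)]
    nlinarith [mul_le_mul hp0 hD0 zero_le_one (by linarith)]
  have hexm : ∀ t, Measurable fun z : Fin N → ℝ => ∑ a, b a t (z a) - p := fun t =>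
    (measurable_sum_pi fun a => hbm a t).sub_const p
  have hexN : ∀ t (z : Fin N → ℝ), ∑ a, b a t (z a) - p ≤ N := fun t z =>
    (Nat.sub_le _ _).trans (sum_pi_le (fun a => hb a t) z)
  have hFm : Measurable F :=
    Finset.measurable_sum _ fun t _ => measurable_from_top.comp (hexm t)
  have hF0 : ∀ z, 0 ≤ F z := fun z => Finset.sum_nonneg fun t _ => Nat.cast_nonneg _
  have hFK : ∀ z, |F z| ≤ W.card * N := fun z => by
    rw [abs_of_nonneg (hF0 z), ← nsmul_eq_mul]
    exact Finset.sum_le_card_nsmul _ _ _ fun t _ => by exact_mod_cast hexN t z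
  have hFint : ∫ z, F z ∂(Measure.pi fun _ => ν) ≤ W.card * (1 / (8 * D)) := by
    rw [hF, integral_finsetSum _ fun t _ => integrable_pi_of_natCast_le (hexm t) (hexN t),
      ← nsmul_eq_mul]
    exact Finset.sum_le_card_nsmul _ _ _ fun t _ =>
      (integral_excess_le hε hε1 (fun a => hbm a t) (fun a => hb a t) (hmean t)).trans hδ
  have hbi : ∀ a t, Integrable (fun u => (b a t u : ℝ)) ν := fun a t =>
    Integrable.of_bound (measurable_from_top.comp (hbm a t)).aestronglyMeasurable 1
      (Filter.Eventually.of_forall fun u => by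
        rw [Real.norm_eq_abs, abs_of_nonneg (Nat.cast_nonneg _)]
        exact_mod_cast hb a t u)
  have hosc : ∀ (z : Fin N → ℝ) (a : Fin N) (u : ℝ),
      F (Function.update z a u) ≤ F z + ∑ t ∈ W, (b a t u : ℝ) := fun z a u => by
    simp only [hF]
    rw [← Finset.sum_add_distrib]
    refine Finset.sum_le_sum fun t _ => ?_
    rw [← Nat.cast_add, Nat.cast_le]
    have h1 := Finset.add_sum_erase Finset.univ (fun i => b i t (Function.update z a u i))
      (Finset.mem_univ a)
    have h2 := Finset.add_sum_erase Finset.univ (fun i => b i t (z i)) (Finset.mem_univ a)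
    have h3 : ∑ i ∈ Finset.univ.erase a, b i t (Function.update z a u i) =
        ∑ i ∈ Finset.univ.erase a, b i t (z i) := Finset.sum_congr rfl fun i hi => by
      rw [Function.update_of_ne (Finset.ne_of_mem_erase hi)]
    simp only [Function.update_self] at h1
    rw [h3] at h1
    omega
  have hmgf := integral_exp_pi_le_of_osc (ν := ν) (K := W.card * N) (D := D) hl0 hlD N F
    (fun a u => ∑ t ∈ W, (b a t u : ℝ)) (fun a => ∑ t ∈ W, ∫ u, (b a t u : ℝ) ∂ν) hFm
    (fun a => Finset.measurable_sum _ fun t _ => measurable_from_top.comp (hbm a t)) hFK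
    (fun a u => Finset.sum_nonneg fun t _ => Nat.cast_nonneg _)
    (fun a u => by exact_mod_cast hbD a u)
    (fun a => (integral_finsetSum _ fun t _ => hbi a t).le) hosc
  -- The sum of all mean influences is the expected number of arrivals during `W`.
  have hΔ : ∑ a, ∑ t ∈ W, ∫ u, (b a t u : ℝ) ∂ν ≤ W.card * p := by
    rw [Finset.sum_comm, ← nsmul_eq_mul]
    refine Finset.sum_le_card_nsmul _ _ _ fun t _ => (hmean t).trans ?_
    nlinarith
  have hei : Integrable (fun z => Real.exp (l * F z)) (Measure.pi fun _ : Fin N => ν) :=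
    Integrable.of_bound (Real.measurable_exp.comp (hFm.const_mul l)).aestronglyMeasurable
      (Real.exp (l * (W.card * N))) (Filter.Eventually.of_forall fun z => by
        rw [Real.norm_eq_abs, abs_of_pos (Real.exp_pos _), Real.exp_le_exp]
        exact mul_le_mul_of_nonneg_left ((le_abs_self _).trans (hFK z)) hl0)
  have hch := ProbabilityTheory.measure_ge_le_exp_mul_mgf (1 / (4 * D) * (W.card : ℝ)) hl0 hei
  rw [← ENNReal.ofReal_toReal (measure_ne_top _ _)]
  refine ENNReal.ofReal_le_ofReal (hch.trans ?_)
  refine (mul_le_mul_of_nonneg_left hmgf (Real.exp_pos _).le).trans ?_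
  rw [← Real.exp_add, Real.exp_le_exp]
  have h1 := mul_le_mul_of_nonneg_left hFint hl0
  have h2 := mul_le_mul_of_nonneg_left hΔ (show 0 ≤ 2 * l ^ 2 * D by positivity)
  have e : -l * (1 / (4 * D) * (W.card : ℝ)) + (l * (W.card * (1 / (8 * D))) +
      2 * l ^ 2 * D * (W.card * p)) = -(W.card / (512 * p * D ^ 3)) := by
    rw [hl]
    field_simp
    ring
  linarith

/-! ### Collections of thresholds as independent random variables -/

/-- The number of thresholds of the collection with index `q` and index below `T` that are
crossed between `x` and `y`, if the collection has offset `u`. -/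
noncomputable def blockHit (D T q : ℕ) (u x y : ℝ) : ℕ :=
  ∑ t ∈ (Finset.range T).filter fun t => (t - 1) / (D + 1) = q, hit D t u x y

theorem crossings_eq_sum_blockHit {D T : ℕ} {s : ℕ → ℝ} (hs : ∀ q, s q ∈ Set.Ioc (0 : ℝ) 1)
    {x y : ℝ} (hT : y ≤ T) :
    crossings D s x y = ∑ q : Fin T, blockHit D T q (s q) x y := by
  rw [crossings_eq_sum hs hT, Fin.sum_univ_eq_sum_range (fun q => blockHit D T q (s q) x y)]
  rw [← Finset.sum_fiberwise_of_maps_to (t := Finset.range T)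
    (g := fun t : ℕ => (t - 1) / (D + 1)) fun t ht => ?_]
  · refine Finset.sum_congr rfl fun q _ => Finset.sum_congr rfl fun t ht => ?_
    rw [(Finset.mem_filter.1 ht).2]
  · refine Finset.mem_range.2 (lt_of_le_of_lt ((Nat.div_le_self _ _).trans (Nat.sub_le t 1)) ?_)
    exact Finset.mem_range.1 ht

theorem blockHit_le_one {D T q : ℕ} {u x y : ℝ} (hxy : y ≤ x + 1) :
    blockHit D T q u x y ≤ 1 := by
  classical
  unfold blockHit hit
  rw [← Finset.card_filter, Finset.card_le_one]
  intro t ht t' ht'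
  obtain ⟨_, _, h1, h2⟩ := Finset.mem_filter.1 ht
  obtain ⟨_, _, h1', h2'⟩ := Finset.mem_filter.1 ht'
  have h3 : (t : ℝ) < t' + 1 := by linarith
  have h4 : (t' : ℝ) < t + 1 := by linarith
  have h5 : t < t' + 1 := by exact_mod_cast h3
  have h6 : t' < t + 1 := by exact_mod_cast h4
  omega

theorem blockHit_le {D T q : ℕ} (hD : 1 ≤ D) {u x y : ℝ} : blockHit D T q u x y ≤ D := by
  classical
  unfold blockHit hit
  rw [← Finset.card_filter]
  have hsub : ((Finset.range T).filter fun t => (t - 1) / (D + 1) = q).filter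
      (fun t : ℕ => HasThreshold D t ∧ x < t + u ∧ t + u ≤ y) ⊆
      Finset.Ioc (q * (D + 1) + 1) (q * (D + 1) + 1 + D) := by
    intro t ht
    obtain ⟨ht, hth, _⟩ := Finset.mem_filter.1 ht
    obtain ⟨k, rfl⟩ : ∃ k, t = k + 1 := ⟨t - 1, by have := hth.1; omega⟩
    have hq := (Finset.mem_filter.1 ht).2
    rw [Nat.add_sub_cancel] at hq
    have h1 := Nat.div_add_mod k (D + 1)
    rw [hq, mul_comm] at h1
    have h2 : k % (D + 1) < D + 1 := Nat.mod_lt _ (by omega)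
    have h3 : k % (D + 1) ≠ 0 := fun h0 => by
      apply hth.2
      rw [Nat.add_mod, h0, zero_add, Nat.mod_mod]
      exact Nat.mod_eq_of_lt (by omega)
    exact Finset.mem_Ioc.2 ⟨by omega, by omega⟩
  refine (Finset.card_le_card hsub).trans ?_
  simp

theorem sum_blockHit {D T q : ℕ} {u : ℝ} {f : ℕ → ℝ} (hf : Monotone f) {v w : ℕ} (hvw : v ≤ w) :
    ∑ t ∈ Finset.Ico v w, blockHit D T q u (f t) (f (t + 1)) = blockHit D T q u (f v) (f w) := by
  induction w, hvw using Nat.le_induction with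
  | base =>
    rw [Finset.Ico_self, Finset.sum_empty]
    symm
    refine Finset.sum_eq_zero fun t _ => ?_
    unfold hit
    rw [if_neg]
    rintro ⟨_, h1, h2⟩
    linarith
  | succ w hvw ih =>
    rw [Finset.sum_Ico_succ_top hvw, ih]
    unfold blockHit
    rw [← Finset.sum_add_distrib]
    exact Finset.sum_congr rfl fun t _ => hit_add (hf hvw) (hf (Nat.le_succ w))

theorem measurable_hit (D t : ℕ) (x y : ℝ) : Measurable fun u => hit D t u x y := by
  classical
  unfold hit
  refine Measurable.ite ?_ measurable_const measurable_const
  by_cases h : HasThreshold D t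
  · simp only [h, true_and]
    exact (measurableSet_lt measurable_const (measurable_id.const_add _)).inter
      (measurableSet_le (measurable_id.const_add _) measurable_const)
  · simp [h]

theorem measurable_blockHit (D T q : ℕ) (x y : ℝ) : Measurable fun u => blockHit D T q u x y :=
  Finset.measurable_sum _ fun t _ => measurable_hit D t x y

/-- The uniform distribution on `(0, 1]`. -/
noncomputable def uniform : Measure ℝ := volume.restrict (Set.Ioc (0 : ℝ) 1)

instance : IsProbabilityMeasure uniform := ⟨by simp [uniform]⟩

theorem integral_hit_le (D t : ℕ) (x y : ℝ) :
    ∫ u, (hit D t u x y : ℝ) ∂uniform ≤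
      (volume (Set.Ioc x y ∩ Set.Ioc (t : ℝ) (t + 1))).toReal := by
  classical
  have hmeas : MeasurableSet {u : ℝ | x < t + u ∧ t + u ≤ y} :=
    (measurableSet_lt measurable_const (measurable_id.const_add _)).inter
      (measurableSet_le (measurable_id.const_add _) measurable_const)
  calc ∫ u, (hit D t u x y : ℝ) ∂uniform
      ≤ ∫ u, Set.indicator {u : ℝ | x < t + u ∧ t + u ≤ y} (fun _ => (1 : ℝ)) u ∂uniform := by
        refine integral_mono_of_nonneg (Filter.Eventually.of_forall fun u => Nat.cast_nonneg _)
          ((integrable_const 1).indicator hmeas) (Filter.Eventually.of_forall fun u => ?_)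
        simp only [hit, Set.indicator_apply]
        split_ifs with h1 h2 h2
        · simp
        · exact absurd h1.2 h2
        · simp
        · simp
    _ = (volume (Set.Ioc x y ∩ Set.Ioc (t : ℝ) (t + 1))).toReal := by
        rw [integral_indicator_const _ hmeas, smul_eq_mul, mul_one, measureReal_def, uniform,
          Measure.restrict_apply hmeas,
          ← measure_preimage_add volume (t : ℝ) (Set.Ioc x y ∩ Set.Ioc (t : ℝ) (t + 1))]
        congr 2
        ext u
        constructor
        · rintro ⟨⟨h1, h2⟩, h3, h4⟩
          exact ⟨⟨h1, h2⟩, by linarith, by linarith⟩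
        · rintro ⟨⟨h1, h2⟩, h3, h4⟩
          exact ⟨⟨h1, h2⟩, by linarith, by linarith⟩

/-- The threshold of index `t` is uniform on `(t, t + 1]`. These intervals are disjoint, so the
expected crossings add up to at most the length of `(x, y]`; dependence within a collection does not
affect expectations. -/
theorem sum_integral_blockHit_le {D T : ℕ} {x y : ℝ} (hxy : x ≤ y) :
    ∑ q : Fin T, ∫ u, (blockHit D T q u x y : ℝ) ∂uniform ≤ y - x := by
  have hint : ∀ t, Integrable (fun u => (hit D t u x y : ℝ)) uniform := fun t =>
    Integrable.of_bound (measurable_from_top.comp (measurable_hit D t x y)).aestronglyMeasurable 1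
      (Filter.Eventually.of_forall fun u => by
        rw [Real.norm_eq_abs, abs_of_nonneg (Nat.cast_nonneg _)]
        unfold hit
        split_ifs <;> simp)
  have h1 : ∀ q, ∫ u, (blockHit D T q u x y : ℝ) ∂uniform =
      ∑ t ∈ (Finset.range T).filter fun t => (t - 1) / (D + 1) = q,
        ∫ u, (hit D t u x y : ℝ) ∂uniform := fun q => by
    simp only [blockHit]
    push_cast
    exact integral_finsetSum _ fun t _ => hint t
  simp only [h1]
  rw [Fin.sum_univ_eq_sum_range (fun q => ∑ t ∈ (Finset.range T).filter
      fun t => (t - 1) / (D + 1) = q, ∫ u, (hit D t u x y : ℝ) ∂uniform) T,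
    Finset.sum_fiberwise_of_maps_to fun t ht => Finset.mem_range.2 (lt_of_le_of_lt
      ((Nat.div_le_self _ _).trans (Nat.sub_le t 1)) (Finset.mem_range.1 ht))]
  refine (Finset.sum_le_sum fun t _ => integral_hit_le D t x y).trans ?_
  rw [← ENNReal.toReal_sum fun t _ => ((measure_mono Set.inter_subset_left).trans_lt
    (measure_Ioc_lt_top (a := x) (b := y))).ne]
  rw [← measure_biUnion_finset ?_ fun t _ => measurableSet_Ioc.inter measurableSet_Ioc]
  · refine (ENNReal.toReal_mono measure_Ioc_lt_top.ne
      (measure_mono (Set.iUnion₂_subset fun t _ => Set.inter_subset_left))).trans ?_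
    rw [Real.volume_Ioc, ENNReal.toReal_ofReal (by linarith)]
  · intro t _ t' _ htt
    refine Set.disjoint_left.2 fun z hz hz' => htt ?_
    have h3 : (t : ℝ) < t' + 1 := by linarith [hz.2.1, hz'.2.2]
    have h4 : (t' : ℝ) < t + 1 := by linarith [hz'.2.1, hz.2.2]
    have h5 : t < t' + 1 := by exact_mod_cast h3
    have h6 : t' < t + 1 := by exact_mod_cast h4
    omega

theorem monotone_total {n : ℕ} (x : Fin n → ℝ) {c : ℕ → Fin n → ℝ} (hc : ∀ i j, 0 ≤ c i j)
    (j : Fin n) : Monotone fun i => total x c i j :=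
  monotone_nat_of_le_succ fun i => by
    rw [total_succ]
    linarith [hc (i + 1) j]

section Transfer

variable {Ω : Type*} [MeasurableSpace Ω] {μ : Measure Ω} {n : ℕ} {s : Fin n → ℕ → Ω → ℝ}

theorem IsUniformOffsets.ae_mem (hs : IsUniformOffsets μ s) :
    ∀ᵐ ω ∂μ, ∀ j q, s j q ω ∈ Set.Ioc (0 : ℝ) 1 := by
  rw [ae_all_iff]
  intro j
  rw [ae_all_iff]
  intro q
  have h : ∀ᵐ u ∂(μ.map (s j q)), u ∈ Set.Ioc (0 : ℝ) 1 := by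
    rw [hs.law j q]
    exact ae_restrict_mem measurableSet_Ioc
  exact ae_of_ae_map (hs.measurable j q).aemeasurable h

theorem IsUniformOffsets.map_pi [IsProbabilityMeasure μ] (hs : IsUniformOffsets μ s) {N : ℕ}
    {e : Fin N → Fin n × ℕ} (he : Function.Injective e) :
    μ.map (fun ω a => s (e a).1 (e a).2 ω) = Measure.pi fun _ => uniform := by
  have h := (ProbabilityTheory.iIndepFun_iff_map_fun_eq_pi_map
    (f := fun a => s (e a).1 (e a).2) fun a => (hs.measurable _ _).aemeasurable).1
    (hs.indep.precomp he)
  rw [h]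
  congr 1
  funext a
  exact hs.law _ _

/-- The numbers of arrivals up to step `V` as sums over independent random variables. -/
theorem IsUniformOffsets.exists_blocks [IsProbabilityMeasure μ] (hs : IsUniformOffsets μ s)
    {D p : ℕ} (hD : 1 ≤ D) {ε : ℝ} {x : Fin n → ℝ} (hx : ∀ j, 0 ≤ x j) {c : ℕ → Fin n → ℝ}
    (hc : IsFiller p ε c) (V : ℕ) :
    ∃ (N : ℕ) (b : Fin N → ℕ → ℝ → ℕ) (r : Fin N → Ω → ℝ),
      (∀ a t, Measurable (b a t)) ∧ (∀ a t u, b a t u ≤ 1) ∧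
      (∀ t, ∑ a, ∫ u, (b a t u : ℝ) ∂uniform ≤ (1 - ε) * p) ∧
      (∀ a v w u, ∑ t ∈ Finset.Ico v w, b a t u ≤ D) ∧
      Measurable (fun ω a => r a ω) ∧ μ.map (fun ω a => r a ω) = Measure.pi (fun _ => uniform) ∧
      ∀ᵐ ω ∂μ, ∀ t < V, arrivals D (fun j q => s j q ω) x c t = ∑ a, b a t (r a ω) := by
  -- One bound on the water in all cups up to step `V`; collections with index at least `T` are not
  -- reached, which leaves finitely many random variables.
  obtain ⟨T, hT⟩ := exists_nat_ge (∑ j, total x c V j)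
  have hT' : ∀ j, ∀ t < V, total x c (t + 1) j ≤ T := fun j t ht =>
    ((monotone_total x hc.nonneg j (Nat.succ_le_of_lt ht)).trans
      (Finset.single_le_sum (f := fun j => total x c V j)
        (fun j _ => total_nonneg hx hc.nonneg V j) (Finset.mem_univ j))).trans hT
  let e : Fin n × Fin T ≃ Fin (Fintype.card (Fin n × Fin T)) := Fintype.equivFin _
  have hle : ∀ t j, total x c t j ≤ total x c (t + 1) j := fun t j =>
    monotone_total x hc.nonneg j (Nat.le_succ t)
  refine ⟨_, fun a t u => blockHit D T (e.symm a).2 u (total x c t (e.symm a).1)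
    (total x c (t + 1) (e.symm a).1), fun a => s (e.symm a).1 (e.symm a).2,
    fun a t => measurable_blockHit _ _ _ _ _, fun a t u => blockHit_le_one ?_, fun t => ?_,
    fun a v w u => ?_, measurable_pi_lambda _ fun a => hs.measurable _ _, ?_, ?_⟩
  · rw [total_succ]
    linarith [hc.le_one (t + 1) (e.symm a).1]
  · rw [Equiv.sum_comp e.symm (fun a : Fin n × Fin T =>
      ∫ u, (blockHit D T a.2 u (total x c t a.1) (total x c (t + 1) a.1) : ℝ) ∂uniform),
      Fintype.sum_prod_type]
    refine (Finset.sum_le_sum fun j _ => sum_integral_blockHit_le (hle t j)).trans ?_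
    simp only [total_succ, add_sub_cancel_left]
    exact hc.sum_le _
  · rcases le_total v w with h | h
    · rw [sum_blockHit (f := fun t => total x c t (e.symm a).1) (monotone_total x hc.nonneg _) h]
      exact blockHit_le hD
    · simp [Finset.Ico_eq_empty_of_le h]
  · refine hs.map_pi (e := fun a => ((e.symm a).1, ((e.symm a).2 : ℕ))) fun a a' h => ?_
    rw [Prod.mk.injEq] at h
    exact e.symm.injective (Prod.ext h.1 (Fin.ext h.2))
  · filter_upwards [hs.ae_mem] with ω hω t ht
    unfold arrivals
    rw [Equiv.sum_comp e.symm (fun a : Fin n × Fin T =>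
      blockHit D T a.2 (s a.1 a.2 ω) (total x c t a.1) (total x c (t + 1) a.1)),
      Fintype.sum_prod_type]
    exact Finset.sum_congr rfl fun j _ => crossings_eq_sum_blockHit (hω j) (hT' j t ht)

theorem IsUniformOffsets.measure_arrivals_gt_le [IsProbabilityMeasure μ]
    (hs : IsUniformOffsets μ s) {D p : ℕ} (hD : 1 ≤ D) {ε : ℝ} (hε : 0 < ε) (hε1 : ε ≤ 1)
    {x : Fin n → ℝ} (hx : ∀ j, 0 ≤ x j) {c : ℕ → Fin n → ℝ} (hc : IsFiller p ε c) (t : ℕ) :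
    μ {ω | p < arrivals D (fun j q => s j q ω) x c t} ≤
      ENNReal.ofReal (2 / ε * Real.exp (-(ε ^ 2 * p / 4))) := by
  obtain ⟨N, b, r, hbm, hb, hmean, -, hr, hmap, harr⟩ :=
    hs.exists_blocks hD hx hc (t + 1)
  have h := measure_excess_pos_le hε hε1 (fun a => hbm a t) (fun a => hb a t) (hmean t)
  rw [← hmap, Measure.map_apply hr
    (measurableSet_lt measurable_const (measurable_sum_pi fun a => hbm a t))] at h
  refine le_trans (measure_mono_ae ?_) h
  filter_upwards [harr] with ω hω h1
  have h1 : p < arrivals D (fun j q => s j q ω) x c t := h1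
  rw [hω t (Nat.lt_succ_self t)] at h1
  exact h1

theorem IsUniformOffsets.measure_sum_arrivals_ge_le [IsProbabilityMeasure μ]
    (hs : IsUniformOffsets μ s) {D p : ℕ} {ε : ℝ} (hp : 1 ≤ p) (hD : 1 ≤ D) (hε : 0 < ε)
    (hε1 : ε ≤ 1) {x : Fin n → ℝ}
    (hx : ∀ j, 0 ≤ x j) {c : ℕ → Fin n → ℝ} (hc : IsFiller p ε c)
    (hδ : 2 / ε * Real.exp (-(ε ^ 2 * p / 4)) ≤ 1 / (8 * D)) {u v : ℕ} (huv : u ≤ v) :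
    μ {ω | 1 / (4 * D) * ((v : ℝ) - u) ≤
        ∑ t ∈ Finset.Ico u v, ((arrivals D (fun j q => s j q ω) x c t - p : ℕ) : ℝ)} ≤
      ENNReal.ofReal (Real.exp (-(((v : ℝ) - u) / (512 * p * D ^ 3)))) := by
  obtain ⟨N, b, r, hbm, hb, hmean, hbD, hr, hmap, harr⟩ :=
    hs.exists_blocks hD hx hc v
  have h := measure_sum_excess_ge_le hp hD hε hε1 hbm hb hmean (W := Finset.Ico u v)
    (fun a z => hbD a u v z) hδ
  have hm : Measurable fun z : Fin N → ℝ =>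
      ∑ t ∈ Finset.Ico u v, ((∑ a, b a t (z a) - p : ℕ) : ℝ) :=
    Finset.measurable_sum _ fun t _ => measurable_from_top.comp
      ((measurable_sum_pi fun a => hbm a t).sub_const p)
  rw [← hmap, Measure.map_apply hr (measurableSet_le measurable_const hm),
    Nat.card_Ico, Nat.cast_sub huv] at h
  refine le_trans (measure_mono_ae ?_) h
  filter_upwards [harr] with ω hω h1
  have h1 : 1 / (4 * D) * ((v : ℝ) - u) ≤
    ∑ t ∈ Finset.Ico u v, ((arrivals D (fun j q => s j q ω) x c t - p : ℕ) : ℝ) := h1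
  rw [Finset.sum_congr rfl fun t ht => by rw [hω t (Finset.mem_Ico.1 ht).2]] at h1
  exact h1

end Transfer

/-! ### Probability that the counters are not, or not recently, clear -/

theorem sum_exp_neg_le {κ : ℝ} (hκ : 0 < κ) (i T : ℕ) :
    ∑ u ∈ Finset.range (i - T), Real.exp (-(κ * ((i : ℝ) - u))) ≤ Real.exp (-(κ * T)) / κ := by
  rw [le_div_iff₀ hκ, Finset.sum_mul]
  rcases Nat.le_total i T with h | h
  · rw [Nat.sub_eq_zero_of_le h, Finset.sum_range_zero]
    exact (Real.exp_pos _).le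
  calc ∑ u ∈ Finset.range (i - T), Real.exp (-(κ * ((i : ℝ) - u))) * κ
      ≤ ∑ u ∈ Finset.range (i - T), (Real.exp (-(κ * ((i : ℝ) - (u + 1 : ℕ)))) -
          Real.exp (-(κ * ((i : ℝ) - u)))) := Finset.sum_le_sum fun u _ => by
        rw [show -(κ * ((i : ℝ) - (u + 1 : ℕ))) = -(κ * ((i : ℝ) - u)) + κ by push_cast; ring,
          Real.exp_add]
        have := mul_le_mul_of_nonneg_left (Real.add_one_le_exp κ)
          (Real.exp_pos (-(κ * ((i : ℝ) - u)))).le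
        linarith
    _ ≤ Real.exp (-(κ * T)) := by
        rw [Finset.sum_range_sub (fun u : ℕ => Real.exp (-(κ * ((i : ℝ) - u)))),
          Nat.cast_sub h, sub_sub_cancel]
        linarith [Real.exp_pos (-(κ * ((i : ℝ) - (0 : ℕ))))]

section

variable {Ω : Type*} [MeasurableSpace Ω] {μ : Measure Ω} {n : ℕ} {s : Fin n → ℕ → Ω → ℝ}

/-- It is unlikely that the counters have not all been zero recently. -/
theorem IsUniformOffsets.measure_not_recently_clear_le [IsProbabilityMeasure μ]
    (hs : IsUniformOffsets μ s) {D p : ℕ} {ε : ℝ} (hp : 1 ≤ p) (hD : 1 ≤ D) (hε : 0 < ε)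
    (hε1 : ε ≤ 1) {x : Fin n → ℝ}
    (hx : ∀ j, 0 ≤ x j) {c : ℕ → Fin n → ℝ} (hc : IsFiller p ε c)
    (hδ : 2 / ε * Real.exp (-(ε ^ 2 * p / 4)) ≤ 1 / (8 * D)) {S : Ω → ℕ → Finset (Fin n)}
    (hS : ∀ ω, FollowsSmoothedGreedy D p (fun j q => s j q ω) x c (S ω)) {i : ℕ}
    (hi : 2 * (∑ j, x j) ≤ 1 / D * i) (T : ℕ) :
    μ {ω | ¬ ∃ u ≤ i, i ≤ u + T ∧
        (stateAfter D (fun j q => s j q ω) x c (S ω) u).IsClear} ≤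
      ENNReal.ofReal (Real.exp (-((i : ℝ) / (512 * p * D ^ 3))) +
        512 * p * D ^ 3 * Real.exp (-((T : ℝ) / (512 * p * D ^ 3)))) := by
  have hD0 : (0 : ℝ) < D := by exact_mod_cast hD
  have hp0 : (0 : ℝ) < p := by exact_mod_cast hp
  set E : ℕ → Set Ω := fun u => {ω | 1 / (4 * D) * ((i : ℝ) - u) ≤
    ∑ t ∈ Finset.Ico u i, ((arrivals D (fun j q => s j q ω) x c t - p : ℕ) : ℝ)} with hE
  have hEμ : ∀ u ≤ i, μ (E u) ≤ ENNReal.ofReal (Real.exp (-(((i : ℝ) - u) / (512 * p * D ^ 3)))) :=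
    fun u hu => hs.measure_sum_arrivals_ge_le hp hD hε hε1 hx hc hδ hu
  -- The choices `S ω` need not be measurable in `ω`. Up to a null set the event is covered by
  -- events that speak of arrivals only.
  have hsub : μ {ω | ¬ ∃ u ≤ i, i ≤ u + T ∧
      (stateAfter D (fun j q => s j q ω) x c (S ω) u).IsClear} ≤
      μ (E 0 ∪ ⋃ u ∈ Finset.range (i - T), E u) := by
    refine measure_mono_ae ?_
    filter_upwards [hs.ae_mem] with ω hω hnot
    rcases recently_clear_or_excess hD hω hx hc.le_one (hS ω) hi T with h | ⟨u, hu, h⟩ | h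
    · left
      simpa [hE] using h
    · right
      refine Set.mem_iUnion₂.2 ⟨u, Finset.mem_range.2 (by omega), h⟩
    · exact absurd h hnot
  refine hsub.trans ((measure_union_le _ _).trans ?_)
  rw [ENNReal.ofReal_add (Real.exp_pos _).le (by positivity)]
  refine add_le_add ?_ ?_
  · have h := hEμ 0 (Nat.zero_le i)
    rwa [Nat.cast_zero, sub_zero] at h
  · refine (measure_biUnion_finset_le _ _).trans ((Finset.sum_le_sum fun u hu =>
      hEμ u (by have := Finset.mem_range.1 hu; omega)).trans ?_)
    rw [← ENNReal.ofReal_sum_of_nonneg fun u _ => (Real.exp_pos _).le]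
    refine ENNReal.ofReal_le_ofReal ?_
    have h := sum_exp_neg_le (κ := 1 / (512 * p * D ^ 3)) (by positivity) i T
    rw [div_div_eq_mul_div, div_one] at h
    simp only [one_div_mul_eq_div] at h
    linarith

/-- It is unlikely that the counters are not all zero. -/
theorem IsUniformOffsets.measure_not_clear_le [IsProbabilityMeasure μ]
    (hs : IsUniformOffsets μ s) {D p : ℕ} {ε : ℝ} (hp : 1 ≤ p) (hD : 1 ≤ D) (hε : 0 < ε)
    (hε1 : ε ≤ 1) {x : Fin n → ℝ}
    (hx : ∀ j, 0 ≤ x j) {c : ℕ → Fin n → ℝ} (hc : IsFiller p ε c)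
    (hδ : 2 / ε * Real.exp (-(ε ^ 2 * p / 4)) ≤ 1 / (8 * D)) {S : Ω → ℕ → Finset (Fin n)}
    (hS : ∀ ω, FollowsSmoothedGreedy D p (fun j q => s j q ω) x c (S ω)) {i : ℕ}
    (hi : 2 * (∑ j, x j) ≤ 1 / D * i) (T : ℕ) :
    μ {ω | ¬ (stateAfter D (fun j q => s j q ω) x c (S ω) i).IsClear} ≤
      ENNReal.ofReal (Real.exp (-((i : ℝ) / (512 * p * D ^ 3))) +
        512 * p * D ^ 3 * Real.exp (-((T : ℝ) / (512 * p * D ^ 3))) +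
        T * (2 / ε * Real.exp (-(ε ^ 2 * p / 4)))) := by
  have hsub : μ {ω | ¬ (stateAfter D (fun j q => s j q ω) x c (S ω) i).IsClear} ≤
      μ ({ω | ¬ ∃ u ≤ i, i ≤ u + T ∧
        (stateAfter D (fun j q => s j q ω) x c (S ω) u).IsClear} ∪
        ⋃ t ∈ Finset.Ico (i - T) i, {ω | p < arrivals D (fun j q => s j q ω) x c t}) := by
    refine measure_mono_ae ?_
    filter_upwards [hs.ae_mem] with ω hω hnot
    by_contra hcon
    have h1 := fun h => hcon (Or.inl h)
    have h2 := fun h => hcon (Or.inr h)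
    obtain ⟨u, hui, hiT, hu⟩ := not_not.1 h1
    refine hnot (isClear_of_arrivals_le hD hω x hc.le_one (hS ω) hui (fun t ht => ?_) hu)
    by_contra hlt
    have ht := Finset.mem_Ico.1 ht
    exact h2 (Set.mem_iUnion₂.2 ⟨t, Finset.mem_Ico.2 ⟨by omega, ht.2⟩, not_le.1 hlt⟩)
  refine hsub.trans ((measure_union_le _ _).trans ?_)
  rw [ENNReal.ofReal_add (by positivity) (by positivity)]
  refine add_le_add (hs.measure_not_recently_clear_le hp hD hε hε1 hx hc hδ hS hi T) ?_
  refine (measure_biUnion_finset_le _ _).trans ((Finset.sum_le_card_nsmul _ _ _ fun t _ =>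
    hs.measure_arrivals_gt_le hD hε hε1 hx hc t).trans ?_)
  rw [nsmul_eq_mul, ENNReal.ofReal_mul (Nat.cast_nonneg _), ENNReal.ofReal_natCast]
  gcongr
  rw [Nat.card_Ico]
  omega

end

/-! ### Numerical estimates -/

theorem pow_le_factorial_mul_exp {x : ℝ} (hx : 0 ≤ x) (m : ℕ) :
    x ^ m ≤ m.factorial * Real.exp x := by
  have h := Real.pow_div_factorial_le_exp x hx m
  rwa [div_le_iff₀ (by positivity), mul_comm] at h

/-- The claim amounts to `(p D³)⁶ ≤ i⁵`, which follows from `i ≥ p² D⁸` with room to spare. -/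
theorem rpow_sixth_le {p D i : ℕ} (hp : 1 ≤ p) (hD : 1 ≤ D) (hi : (p : ℝ) ^ 2 * D ^ 8 ≤ i) :
    (i : ℝ) ^ (1 / 6 : ℝ) ≤ i / (p * D ^ 3) := by
  have hp1 : (1 : ℝ) ≤ p := by exact_mod_cast hp
  have hD1 : (1 : ℝ) ≤ D := by exact_mod_cast hD
  have h0 : (0 : ℝ) ≤ i := Nat.cast_nonneg _
  have h1 : ((p : ℝ) * D ^ 3) ^ 6 ≤ (i : ℝ) ^ 5 := by
    calc ((p : ℝ) * D ^ 3) ^ 6 = (p : ℝ) ^ 6 * (D : ℝ) ^ 18 := by ring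
      _ ≤ (p : ℝ) ^ 10 * (D : ℝ) ^ 40 := by gcongr <;> first | assumption | norm_num
      _ = ((p : ℝ) ^ 2 * D ^ 8) ^ 5 := by ring
      _ ≤ _ := by gcongr
  have h2 : (i : ℝ) ≤ ((i : ℝ) / (p * D ^ 3)) ^ 6 := by
    rw [div_pow, le_div_iff₀ (by positivity)]
    calc (i : ℝ) * ((p : ℝ) * D ^ 3) ^ 6 ≤ i * (i : ℝ) ^ 5 := by gcongr
      _ = _ := by ring
  calc (i : ℝ) ^ (1 / 6 : ℝ) ≤ (((i : ℝ) / (p * D ^ 3)) ^ 6) ^ (1 / 6 : ℝ) := by gcongr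
    _ = _ := by
      have := Real.pow_rpow_inv_natCast (x := (i : ℝ) / (p * D ^ 3)) (n := 6) (by positivity)
        (by norm_num)
      rw [one_div]
      exact_mod_cast this

theorem exp_neg_div_le {p D i : ℕ} (hp : 1 ≤ p) (hD : 1 ≤ D) (hi : (p : ℝ) ^ 2 * D ^ 8 ≤ i) :
    Real.exp (-((i : ℝ) / (512 * p * D ^ 3))) ≤
      Real.exp (-(1 / 512) * (i : ℝ) ^ (1 / 6 : ℝ)) := by
  rw [Real.exp_le_exp]
  have h := rpow_sixth_le hp hD hi
  have e : (i : ℝ) / (512 * p * D ^ 3) = 1 / 512 * (i / (p * D ^ 3)) := by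
    rw [mul_assoc, div_mul_div_comm, one_mul]
  rw [e]
  linarith

theorem one_le_cube_mul {p : ℕ} {ε : ℝ} (hp : 1 ≤ p) (hε : (p : ℝ) ^ (-(1 / 3) : ℝ) ≤ ε) :
    1 ≤ ε ^ 3 * p := by
  have hp0 : (0 : ℝ) < p := by exact_mod_cast hp
  have h1 : ((p : ℝ) ^ (-(1 / 3) : ℝ)) ^ 3 = (p : ℝ)⁻¹ := by
    rw [← Real.rpow_natCast, ← Real.rpow_mul hp0.le, ← Real.rpow_neg_one]
    norm_num
  have h2 : ((p : ℝ) ^ (-(1 / 3) : ℝ)) ^ 3 ≤ ε ^ 3 := by gcongr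
  rw [h1, inv_le_iff_one_le_mul₀ hp0] at h2
  exact h2

theorem mul_sq_ge_inv {p : ℕ} {ε : ℝ} (hε : 0 < ε) (h3 : 1 ≤ ε ^ 3 * p) :
    1 / ε ≤ ε ^ 2 * p := by
  rw [div_le_iff₀ hε]
  linarith

theorem le_cube_of_cube {p : ℕ} {ε : ℝ} (h3 : 1 ≤ ε ^ 3 * p) :
    (p : ℝ) ≤ (ε ^ 2 * p) ^ 3 := by
  have h : (1 : ℝ) ≤ (ε ^ 3 * p) ^ 2 := one_le_pow₀ h3
  calc (p : ℝ) = p * 1 := (mul_one _).symm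
    _ ≤ p * (ε ^ 3 * p) ^ 2 := by gcongr
    _ = _ := by ring

theorem expected_excess_small {p D : ℕ} {ε : ℝ} (hD : 1 ≤ D) (hε : 0 < ε)
    (h3 : 1 ≤ ε ^ 3 * p) (hA : 128 * D ≤ Real.exp (1 / 64 * (ε ^ 2 * p))) :
    2 / ε * Real.exp (-(ε ^ 2 * p / 4)) ≤ 1 / (8 * D) := by
  have hD0 : (0 : ℝ) < D := by exact_mod_cast hD
  have h1 := mul_sq_ge_inv hε h3
  set q := ε ^ 2 * (p : ℝ) with hq
  have hq0 : 0 ≤ q := by positivity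
  rw [le_div_iff₀ (by positivity)]
  have h2 : q / 8 ≤ Real.exp (q / 8) := by linarith [Real.add_one_le_exp (q / 8)]
  calc 2 / ε * Real.exp (-(q / 4)) * (8 * D)
      = 1 / ε / 8 * (128 * D) * Real.exp (-(q / 4)) := by ring
    _ ≤ Real.exp (q / 8) * Real.exp (1 / 64 * q) * Real.exp (-(q / 4)) := by
        gcongr
        linarith
    _ = Real.exp (q / 8 + 1 / 64 * q + -(q / 4)) := by rw [Real.exp_add, Real.exp_add]
    _ ≤ 1 := Real.exp_le_one_iff.2 (by linarith)

/-- The window is chosen so that its length over `512 p D³` is `p D`. With `q = ε² p`, the lower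
bound on `ε` gives `1/ε ≤ q` and `p ≤ q³`, and `D⁴ ≤ exp(q/16)`. The union bound is then of order
`q⁷ exp(q/16 - q/4)`, and absorbing `q⁷` into another `exp(q/16)` leaves `exp(-q/8)`. -/
theorem window_estimate {p D : ℕ} {ε : ℝ} (hp : 1 ≤ p) (hD : 1 ≤ D) (hε : 0 < ε)
    (hε2 : ε ≤ 1 / 2) (h3 : 1 ≤ ε ^ 3 * p)
    (hA : 128 * D ≤ Real.exp (1 / 64 * (ε ^ 2 * p))) :
    512 * p * D ^ 3 * Real.exp (-(((512 * p ^ 2 * D ^ 4 : ℕ) : ℝ) / (512 * p * D ^ 3))) +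
        (512 * p ^ 2 * D ^ 4 : ℕ) * (2 / ε * Real.exp (-(ε ^ 2 * p / 4))) ≤
      10 ^ 16 * Real.exp (-(1 / 8) * (ε ^ 2 * p)) := by
  have hD1 : (1 : ℝ) ≤ D := by exact_mod_cast hD
  have hp1 : (1 : ℝ) ≤ p := by exact_mod_cast hp
  have h1 := mul_sq_ge_inv hε h3
  have hpq := le_cube_of_cube h3
  have hqp : ε ^ 2 * (p : ℝ) ≤ p * D := by
    have : ε ^ 2 ≤ 1 := by nlinarith
    calc ε ^ 2 * (p : ℝ) ≤ 1 * p := by gcongr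
      _ ≤ p * D := by nlinarith
  set q := ε ^ 2 * (p : ℝ) with hq
  have hq0 : 0 ≤ q := by positivity
  have e1 : ((512 * p ^ 2 * D ^ 4 : ℕ) : ℝ) / (512 * p * D ^ 3) = p * D := by
    push_cast
    field_simp
  have hX := pow_le_factorial_mul_exp (x := (p : ℝ) * D / 2) (by positivity) 3
  have hT1 : 512 * p * D ^ 3 * Real.exp (-(p * D : ℝ)) ≤ 24576 * Real.exp (-(1 / 8) * q) := by
    calc 512 * p * D ^ 3 * Real.exp (-(p * D : ℝ))
        ≤ 512 * p ^ 3 * D ^ 3 * Real.exp (-(p * D : ℝ)) := by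
          gcongr
          exact le_self_pow₀ hp1 (by norm_num)
      _ = 4096 * ((p : ℝ) * D / 2) ^ 3 * Real.exp (-(p * D : ℝ)) := by ring
      _ ≤ 4096 * (Nat.factorial 3 * Real.exp ((p : ℝ) * D / 2)) * Real.exp (-(p * D : ℝ)) := by
          gcongr
      _ = 24576 * (Real.exp ((p : ℝ) * D / 2) * Real.exp (-(p * D : ℝ))) := by
          rw [show (Nat.factorial 3 : ℝ) = 6 by norm_num [Nat.factorial]]
          ring
      _ ≤ 24576 * Real.exp (-(1 / 8) * q) := by
          rw [← Real.exp_add]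
          gcongr
          linarith
  have hD4 : (D : ℝ) ^ 4 ≤ Real.exp (q / 16) := by
    calc (D : ℝ) ^ 4 ≤ (Real.exp (1 / 64 * q)) ^ 4 := by
          gcongr
          linarith
      _ = Real.exp (q / 16) := by
          rw [← Real.exp_nat_mul]
          congr 1
          push_cast
          ring
  have hq7 := pow_le_factorial_mul_exp (x := q / 16) (by positivity) 7
  have hT2 : (512 * p ^ 2 * D ^ 4 : ℕ) * (2 / ε * Real.exp (-(q / 4))) ≤
      1024 * 16 ^ 7 * 5040 * Real.exp (-(1 / 8) * q) := by
    push_cast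
    calc (512 * p ^ 2 * D ^ 4 : ℝ) * (2 / ε * Real.exp (-(q / 4)))
        = 1024 * p ^ 2 * D ^ 4 * (1 / ε) * Real.exp (-(q / 4)) := by ring
      _ ≤ 1024 * (q ^ 3) ^ 2 * Real.exp (q / 16) * q * Real.exp (-(q / 4)) := by gcongr
      _ = 1024 * 16 ^ 7 * (q / 16) ^ 7 * (Real.exp (q / 16) * Real.exp (-(q / 4))) := by ring
      _ ≤ 1024 * 16 ^ 7 * (Nat.factorial 7 * Real.exp (q / 16)) *
            (Real.exp (q / 16) * Real.exp (-(q / 4))) := by gcongr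
      _ = 1024 * 16 ^ 7 * 5040 *
            (Real.exp (q / 16) * (Real.exp (q / 16) * Real.exp (-(q / 4)))) := by
          rw [show (Nat.factorial 7 : ℝ) = 5040 by norm_num [Nat.factorial]]
          ring
      _ = 1024 * 16 ^ 7 * 5040 * Real.exp (-(1 / 8) * q) := by
          rw [← Real.exp_add, ← Real.exp_add]
          congr 2
          ring
  rw [e1]
  have := Real.exp_pos (-(1 / 8) * q)
  linarith

/-- The exponent is at least `2 Y exp k ≥ Y + exp k`; its part `Y` cancels the prefactor. -/
theorem long_window_estimate {Y T k : ℝ} (hY : 1 ≤ Y) (hk : 0 ≤ k)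
    (hT : 1024 * Y ^ 2 * Real.exp k ≤ T) :
    512 * Y * Real.exp (-(T / (512 * Y))) ≤ 512 * Real.exp (-Real.exp k) := by
  have hek : 1 ≤ Real.exp k := Real.one_le_exp hk
  have h1 : Y + Real.exp k ≤ T / (512 * Y) := by
    rw [le_div_iff₀ (by positivity)]
    have hY0 : 0 ≤ Y := zero_le_one.trans hY
    nlinarith [mul_nonneg hY0 (mul_nonneg (sub_nonneg.2 hY) (zero_le_one.trans hek)),
      mul_nonneg (mul_nonneg hY0 hY0) (sub_nonneg.2 hek)]
  have h2 : Y * Real.exp (-Y) ≤ 1 := by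
    rw [Real.exp_neg, ← div_eq_mul_inv, div_le_one (Real.exp_pos _)]
    linarith [Real.add_one_le_exp Y]
  calc 512 * Y * Real.exp (-(T / (512 * Y))) ≤ 512 * Y * Real.exp (-Y + -Real.exp k) := by
        gcongr
        linarith
    _ = 512 * (Y * Real.exp (-Y)) * Real.exp (-Real.exp k) := by rw [Real.exp_add]; ring
    _ ≤ 512 * 1 * Real.exp (-Real.exp k) := by gcongr
    _ = _ := by ring

/-- Every factor of `1 + 2pT` is at most a power of `exp k`: `p ≤ exp k`, `D ≤ exp(d k)`, and the
constant is below `exp(8k)` since `p ≥ 3` forces `k ≥ 1`. The exponents sum to `12 + 6d`, and the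
level 8 of the weight adds `8 ≤ 8 k / ε`. -/
theorem backlog_estimate {p D d : ℕ} {ε k T : ℝ} (hD : 1 ≤ D) (hp : 3 ≤ p) (hε : 0 < ε)
    (hε2 : ε ≤ 1 / 2) (hd : (D : ℝ) ≤ p ^ d) (hk : Real.log p ≤ k)
    (hT : T ≤ 1024 * (p * D ^ 3) ^ 2 * Real.exp k + 1) (hT0 : 0 ≤ T) :
    8 + Real.log (1 + 2 * p * T) / ε ≤ (20 + 6 * d) * (k / ε) := by
  have hp3 : (3 : ℝ) ≤ p := by exact_mod_cast hp
  have hD1 : (1 : ℝ) ≤ D := by exact_mod_cast hD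
  have hpk : (p : ℝ) ≤ Real.exp k := (Real.log_le_iff_le_exp (by linarith)).1 hk
  have hk1 : 1 ≤ k := by
    refine le_trans ?_ hk
    rw [Real.le_log_iff_exp_le (by linarith)]
    exact (Real.exp_one_lt_d9.le.trans (by norm_num)).trans hp3
  have hek : 1 ≤ Real.exp k := Real.one_le_exp (by linarith)
  have hDk : (D : ℝ) ≤ Real.exp (d * k) := by
    rw [Real.exp_nat_mul]
    exact hd.trans (by gcongr)
  have h8 : (2051 : ℝ) ≤ Real.exp (8 * k) := by
    calc (2051 : ℝ) ≤ 2.7 ^ 8 := by norm_num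
      _ ≤ Real.exp 1 ^ 8 := by
          gcongr
          linarith [Real.exp_one_gt_d9]
      _ = Real.exp 8 := by rw [← Real.exp_nat_mul]; norm_num
      _ ≤ Real.exp (8 * k) := Real.exp_le_exp.2 (by linarith)
  have hZ : 1 ≤ (p : ℝ) * (p * D ^ 3) ^ 2 * Real.exp k := by
    have h1 : (1 : ℝ) ≤ p := by linarith
    have h2 : (1 : ℝ) ≤ p * D ^ 3 := one_le_mul_of_one_le_of_one_le h1 (one_le_pow₀ hD1)
    exact one_le_mul_of_one_le_of_one_le
      (one_le_mul_of_one_le_of_one_le h1 (one_le_pow₀ h2)) hek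
  have hpZ : (p : ℝ) ≤ (p : ℝ) * (p * D ^ 3) ^ 2 * Real.exp k := by
    have h2 : (1 : ℝ) ≤ p * D ^ 3 :=
      one_le_mul_of_one_le_of_one_le (by linarith) (one_le_pow₀ hD1)
    rw [mul_assoc]
    exact le_mul_of_one_le_right (by linarith)
      (one_le_mul_of_one_le_of_one_le (one_le_pow₀ h2) hek)
  have hmain : 1 + 2 * p * T ≤ Real.exp ((12 + 6 * d) * k) := by
    calc 1 + 2 * p * T ≤ 1 + 2 * p * (1024 * (p * D ^ 3) ^ 2 * Real.exp k + 1) := by gcongr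
      _ ≤ 2051 * (p * (p * D ^ 3) ^ 2 * Real.exp k) := by linarith
      _ ≤ Real.exp (8 * k) * (Real.exp k * (Real.exp k * Real.exp (d * k) ^ 3) ^ 2 *
            Real.exp k) := by gcongr
      _ = Real.exp ((12 + 6 * d) * k) := by
          rw [← Real.exp_nat_mul, ← Real.exp_add, ← Real.exp_nat_mul, ← Real.exp_add,
            ← Real.exp_add, ← Real.exp_add]
          congr 1
          push_cast
          ring
  have hlog : Real.log (1 + 2 * p * T) ≤ (12 + 6 * d) * k :=
    (Real.log_le_iff_le_exp (by positivity)).2 hmain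
  have hkε : 1 ≤ k / ε := by
    rw [le_div_iff₀ hε]
    linarith
  calc 8 + Real.log (1 + 2 * p * T) / ε ≤ 8 * (k / ε) + (12 + 6 * d) * k / ε := by
        gcongr
        linarith
    _ = _ := by ring

end CupGame

/-! ### Assembly of the two tail bounds -/

theorem mainTheorem8 :
    ∃ A a C₁ c₁ : ℝ, 0 < A ∧ 0 < a ∧ 0 < C₁ ∧ 0 < c₁ ∧
    ∃ B₂ C₂ c₂ : ℕ → ℝ, (∀ d, 0 < B₂ d ∧ 0 < C₂ d ∧ 0 < c₂ d) ∧
    ∀ (n p D : ℕ) (ε δ : ℝ), 1 ≤ p → (p : ℝ) ^ (-(1 / 3) : ℝ) ≤ ε → ε ≤ 1 / 2 →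
      δ = 1 / (D : ℝ) → δ < 1 → A * Real.exp (-a * (ε ^ 2 * p)) ≤ δ →
    ∀ (b : ℝ) (x : Fin n → ℝ), (∀ j, 0 ≤ x j) → ∑ j, x j = b →
    ∀ c : ℕ → Fin n → ℝ, CupGame.IsFiller p ε c →
    ∀ (Ω : Type*) [MeasurableSpace Ω] (μ : MeasureTheory.Measure Ω)
      [MeasureTheory.IsProbabilityMeasure μ] (s : Fin n → ℕ → Ω → ℝ),
      CupGame.IsUniformOffsets μ s →
    ∀ S : Ω → ℕ → Finset (Fin n),
      (∀ ω, CupGame.FollowsSmoothedGreedy D p (fun j q => s j q ω) x c (S ω)) →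
    ∀ i : ℕ, (p : ℝ) ^ 2 / δ ^ 8 ≤ i → 2 * b / δ ≤ i →
      μ {ω | 3 < CupGame.backlog
            (CupGame.stateAfter D (fun j q => s j q ω) x c (S ω) i).fill} ≤
          ENNReal.ofReal (C₁ * Real.exp (-c₁ * (ε ^ 2 * p)) +
            C₁ * Real.exp (-c₁ * (i : ℝ) ^ (1 / 6 : ℝ))) ∧
      ∀ d : ℕ, 1 / (p : ℝ) ^ d ≤ δ → ∀ k : ℝ, Real.log p ≤ k →
        μ {ω | B₂ d * (k / ε) < CupGame.backlog
              (CupGame.stateAfter D (fun j q => s j q ω) x c (S ω) i).fill} ≤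
            ENNReal.ofReal (C₂ d * Real.exp (-Real.exp k) +
              C₂ d * Real.exp (-c₂ d * (i : ℝ) ^ (1 / 6 : ℝ))) := by
  refine ⟨128, 1 / 64, 10 ^ 16, 1 / 512, by norm_num, by norm_num, by norm_num, by norm_num,
    fun d => 20 + 6 * d, fun _ => 512, fun _ => 1 / 512,
    fun d => ⟨by positivity, by norm_num, by norm_num⟩, ?_⟩
  intro n p D ε δ hp hε hε2 hδD hδ1 hδA b x hx hxb c hc Ω _ μ _ s hs S hS i hi hib
  have hp0 : (0 : ℝ) < p := by exact_mod_cast hp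
  have hε0 : 0 < ε := (Real.rpow_pos_of_pos hp0 _).trans_le hε
  have hε1 : ε ≤ 1 := by linarith
  have hδ0 : 0 < δ := lt_of_lt_of_le (by positivity) hδA
  subst hδD
  have hD0 : (0 : ℝ) < D := one_div_pos.1 hδ0
  have hD : 1 ≤ D := by exact_mod_cast hD0
  have h3 := CupGame.one_le_cube_mul hp hε
  have hA : 128 * D ≤ Real.exp (1 / 64 * (ε ^ 2 * p)) := by
    rw [le_div_iff₀ hD0, neg_mul, Real.exp_neg] at hδA
    have := mul_le_mul_of_nonneg_left hδA (Real.exp_pos (1 / 64 * (ε ^ 2 * p))).le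
    rw [mul_one] at this
    refine le_trans (le_of_eq ?_) this
    field_simp
  have hi' : (p : ℝ) ^ 2 * D ^ 8 ≤ i := by
    rwa [one_div_pow, div_div_eq_mul_div, div_one] at hi
  have hib' : 2 * (∑ j, x j) ≤ 1 / (D : ℝ) * i := by
    rwa [div_le_iff₀ hδ0, mul_comm (i : ℝ), ← hxb] at hib
  have hδ := CupGame.expected_excess_small hD hε0 h3 hA
  have hexp := CupGame.exp_neg_div_le hp hD hi'
  refine ⟨?_, fun d hd k hk => ?_⟩
  · have h := hs.measure_not_clear_le hp hD hε0 hε1 hx hc hδ hS hib' (512 * p ^ 2 * D ^ 4)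
    have hw := CupGame.window_estimate hp hD hε0 hε2 h3 hA
    refine (MeasureTheory.measure_mono_ae ?_).trans
      (h.trans (ENNReal.ofReal_le_ofReal ?_))
    · filter_upwards [hs.ae_mem] with ω hω hlt hcl
      exact (CupGame.backlog_le_three_of_clear hD hω hx hc.nonneg hcl).not_gt hlt
    · have h1 : Real.exp (-(1 / 8) * (ε ^ 2 * p)) ≤ Real.exp (-(1 / 512) * (ε ^ 2 * p)) := by
        rw [Real.exp_le_exp]
        have : 0 ≤ ε ^ 2 * p := by positivity
        linarith
      have h2 := Real.exp_pos (-(1 / 512) * (i : ℝ) ^ (1 / 6 : ℝ))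
      linarith
  -- From `1 ≤ ε³ p` and `ε ≤ 1/2`, even `p ≥ 8`.
  · have hp3 : 3 ≤ p := by
      have h1 : ε ^ 3 ≤ (1 / 2) ^ 3 := by gcongr
      have h2 := mul_le_mul_of_nonneg_right h1 hp0.le
      have h4 : (3 : ℝ) ≤ p := by linarith
      exact_mod_cast h4
    have hp1 : (1 : ℝ) ≤ p := by exact_mod_cast hp
    have hD1 : (1 : ℝ) ≤ D := by exact_mod_cast hD
    have hY : 1 ≤ (p : ℝ) * D ^ 3 := one_le_mul_of_one_le_of_one_le hp1 (one_le_pow₀ hD1)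
    have hd' : (D : ℝ) ≤ p ^ d := by
      rwa [one_div_le_one_div (by positivity) hD0] at hd
    -- Long enough for failure probability of order `exp(-exp k)`, yet with logarithm of order `k`
    -- because `D ≤ p ^ d`.
    set T := ⌈1024 * ((p : ℝ) * D ^ 3) ^ 2 * Real.exp k⌉₊ with hT
    have hk0 : 0 ≤ k := (Real.log_nonneg hp1).trans hk
    have h := hs.measure_not_recently_clear_le hp hD hε0 hε1 hx hc hδ hS hib' T
    have hlong := CupGame.long_window_estimate hY hk0 (Nat.le_ceil _ : _ ≤ (T : ℝ))
    have hback := CupGame.backlog_estimate hD hp3 hε0 hε2 hd' hk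
      (Nat.ceil_lt_add_one (by positivity)).le (Nat.cast_nonneg T)
    refine (MeasureTheory.measure_mono_ae ?_).trans
      (h.trans (ENNReal.ofReal_le_ofReal ?_))
    · filter_upwards [hs.ae_mem] with ω hω hlt
      rintro ⟨u, hui, hiT, hu⟩
      exact ((CupGame.backlog_le_of_clear hD hε0 hε2 hω hx hc (hS ω) hui hiT hu).trans
        hback).not_gt hlt
    · have h2 := Real.exp_pos (-(1 / 512) * (i : ℝ) ^ (1 / 6 : ℝ))
      rw [← mul_assoc] at hlong
      linarith
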